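/- **Theorem.** Let $S^1=\mathbb R/2\pi\mathbb Z$, and let $a_1,a_2,\dots\in L^\infty(S^1)$ be complex-valued functions, regarded as $2\pi$-periodic functions on $\mathbb R$, such that for some $l>0$ one has $\|a_i\|_{\infty}\le l^i$ for all $i\ge 1$. Let $\mathcal A=\mathbb C\langle S_1,S_2\rangle/(S_1S_2-S_2S_1=-S_2^2)$ be the unital associative $\mathbb C$-algebra with generators $S_1,S_2$ and this single relation, and let $G$ be the group of invertible elements of the algebra $\mathcal A[[t]]$ of formal power series in the central variable $t$ with coefficients in $\mathcal A$. Say that the equation $$\frac{dv}{dx}=\sum_{i=1}^{\infty}a_i(x)\,v^{i+1}\qquad(1)$$ *determines a center* if there is $\varepsilon>0$ such that for every $r\in\mathbb C$ with $|r|<\varepsilon$ there is a Lipschitz function $v:[0,2\pi]\to\mathbb C$ with $v(0)=r$ that satisfies (1) almost everywhere (the series being convergent), and every such $v$ satisfies $v(2\pi)=r$. Consider also the linear equation $$\frac{dF}{dx}=\Big(\sum_{i=1}^{\infty}a_i(x)\,t^i\,S_1S_2^{\,i-1}\Big)F .\qquad(2)$$ A *fundamental solution* of (2) is a map $F:\mathbb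 R\to G$ with $F(0)=1$ for which the coefficient of each power of $t$ is a linear combination of finitely many fixed elements of $\mathcal A$ with locally Lipschitz functions of $x$ as coefficients, and which satisfies (2) coefficientwise in $t$ for almost every $x$. The *monodromy* of (2) is the homomorphism $\rho:\mathbb Z=\pi_1(S^1)\to G$, $\rho(n)=F(2\pi n)$, where $F$ is a fundamental solution. Then (2) has exactly one monodromy homomorphism $\rho$, and equation (1) determines a center if and only if $\rho$ is trivial, i.e. $\rho(n)=1$ for all $n\in\mathbb Z$. -/

import Mathlib

open MeasureTheory

noncomputable section

namespace CenterProblem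

/-- The circle `S¹ = ℝ / 2πℤ`. -/
abbrev Circ : Type := AddCircle (2 * Real.pi)

instance factTwoPiPos : Fact (0 < 2 * Real.pi) := ⟨Real.two_pi_pos⟩

/-- The space `L^∞(S¹)` of (classes of) essentially bounded measurable complex functions. -/
abbrev LInfty : Type := Lp ℂ ⊤ (volume : Measure Circ)

/-- The space `X` of sequences `(a₁, a₂, …)` in `L^∞(S¹)` with `sup |a_i| ≤ l^i` for all `i`, for
some positive `l` depending on the sequence. -/
def coeffSpace : Set (ℕ+ → LInfty) :=
  {a | ∃ l : ℝ, 0 < l ∧ ∀ i : ℕ+, ‖a i‖ ≤ l ^ (i : ℕ)}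

/-- The value of `a_i`, viewed as a `2π`-periodic function on `ℝ` (up to null sets). -/
def val (a : ℕ+ → LInfty) (i : ℕ+) (x : ℝ) : ℂ := a i (x : Circ)

/-- `v` is a (generalized, i.e. Lipschitz) solution on `[0, 2π]` of `v' = ∑_{i ≥ 1} a_i(x) v^{i+1}`:
for almost every `x` the series on the right converges and `v'(x)` exists and equals its sum. -/
structure IsSolution (a : ℕ+ → LInfty) (v : ℝ → ℂ) : Prop where
  lipschitz : ∃ K : NNReal, LipschitzOnWith K v (Set.Icc 0 (2 * Real.pi))
  ode : ∀ᵐ x ∂(volume.restrict (Set.Icc 0 (2 * Real.pi))), ∃ s : ℂ,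
    HasSum (fun i : ℕ+ => val a i x * v x ^ ((i : ℕ) + 1)) s ∧ HasDerivAt v s x

/-- The equation determines a center: for all sufficiently small initial values `r`, there is a
solution starting at `r`, and the solution starting at `r` returns to `r` at `x = 2π`. -/
def DeterminesCenter (a : ℕ+ → LInfty) : Prop :=
  ∃ ε : ℝ, 0 < ε ∧ ∀ r : ℂ, ‖r‖ < ε →
    (∃ v : ℝ → ℂ, IsSolution a v ∧ v 0 = r) ∧
    ∀ v : ℝ → ℂ, IsSolution a v → v 0 = r → v (2 * Real.pi) = r

/-- The relation `X₁X₂ - X₂X₁ = -X₂²` on non-commutative polynomials in `X₁ = ι 0`, `X₂ = ι 1`. -/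
inductive Rel : FreeAlgebra ℂ (Fin 2) → FreeAlgebra ℂ (Fin 2) → Prop
  | comm : Rel
      (FreeAlgebra.ι ℂ 0 * FreeAlgebra.ι ℂ 1 - FreeAlgebra.ι ℂ 1 * FreeAlgebra.ι ℂ 0)
      (-(FreeAlgebra.ι ℂ 1) ^ 2)

/-- The unital algebra `ℂ⟨S₁, S₂⟩ / ([S₁, S₂] = -S₂²)`. -/
abbrev Alg : Type := RingQuot Rel

/-- The generator `S₁`. -/
def S₁ : Alg := RingQuot.mkAlgHom ℂ Rel (FreeAlgebra.ι ℂ 0)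

/-- The generator `S₂`. -/
def S₂ : Alg := RingQuot.mkAlgHom ℂ Rel (FreeAlgebra.ι ℂ 1)

/-- The right-hand side `ω(x) = ∑_{i ≥ 1} a_i(x) t^i S₁ S₂^{i-1}`, a formal power series in `t`. -/
def omega (a : ℕ+ → LInfty) (x : ℝ) : PowerSeries Alg :=
  PowerSeries.mk fun n =>
    if h : 0 < n then val a ⟨n, h⟩ x • (S₁ * S₂ ^ (n - 1)) else 0

/-- `f : ℝ → M` is locally Lipschitz with almost everywhere derivative `f'`. Here `M` is a complex
vector space, not necessarily of finite dimension, and it is part of the definition that `f` is a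
combination of finitely many fixed vectors with locally Lipschitz scalar coefficients. -/
def HasLipschitzDeriv {M : Type*} [AddCommGroup M] [Module ℂ M] (f f' : ℝ → M) : Prop :=
  ∃ (m : ℕ) (w : Fin m → M) (g g' : Fin m → ℝ → ℂ),
    (∀ j, LocallyLipschitz (g j)) ∧
    (∀ x, f x = ∑ j, g j x • w j) ∧
    ∀ᵐ x : ℝ, (∀ j, HasDerivAt (g j) (g' j x) x) ∧ f' x = ∑ j, g' j x • w j

/-- `F : ℝ → G`, with `G` the group of invertible formal power series, is a fundamental solution of
`F' = ω F`: `F(0) = 1`, and the equation holds coefficientwise in `t`, almost everywhere in `x`. -/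
structure IsFundamentalSolution (a : ℕ+ → LInfty) (F : ℝ → (PowerSeries Alg)ˣ) : Prop where
  init : F 0 = 1
  ode : ∀ n : ℕ, HasLipschitzDeriv
    (fun x => PowerSeries.coeff n (F x : PowerSeries Alg))
    (fun x => PowerSeries.coeff n (omega a x * (F x : PowerSeries Alg)))

/-- The homomorphism `ρ : π₁(S¹) = ℤ → G` is the monodromy of `F' = ω F`: `ρ(n) = F(2πn)` for a
fundamental solution `F`. -/
def IsMonodromy (a : ℕ+ → LInfty) (ρ : Multiplicative ℤ →* (PowerSeries Alg)ˣ) : Prop :=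
  ∃ F : ℝ → (PowerSeries Alg)ˣ, IsFundamentalSolution a F ∧
    ∀ n : ℤ, ρ (Multiplicative.ofAdd n) = F (2 * Real.pi * n)

end CenterProblem

end

noncomputable section

namespace CenterProblem

/-! Since `ω` has no constant term, (2) is triangular in powers of `t` and is solved by iterated
integrals. Uniqueness and periodicity of `ω` give `F(x + 2π) = F(x) F(2π)`, so the unique monodromy
is generated by `F(2π)`.

The bridge to (1) is the inverse `G = F⁻¹`, which satisfies `G' = -Gω`. Let `S₁` act on sequences of
Taylor coefficients as differentiation and `S₂` as the shift. For fixed `m`, the `(m, n + m)`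
entries `d_n` of the `tⁿ` coefficients of `G` obey `d_{n+1}' = -∑_{i+j=n} (j+m+1) α_i d_j`, with
`α_i = a_{i+1}`. This is exactly the condition that `∑ d_n(x) v^{n+m+1}` be a formal first integral
of (1), equal to `v^{m+1}` at `x = 0`. Geometric bounds on `d_n` (`IsFirstIntegral.norm_le`) make it
a genuine one for small solutions (`IsFirstIntegral.hasSum`): `∑ d_n(2π) v(2π)^{n+m+1} =
v(0)^{m+1}`.

If `G(2π) = 1`, the case `m = 0` reads `v(2π) = v(0)`; existence of `v` is Picard's theorem, and no
uniqueness theorem for (1) is needed. Conversely, a center makes a power series in `r` vanish near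
`0`, so `d_n(2π) = 0` for all `n ≥ 1` and all `m`. The `tⁿ` coefficient of `G` is homogeneous of
degree `n`, and its entries are the values at `m + 1` of a polynomial expanded in rising factorials.
Vanishing for all `m` therefore kills the coefficient (`eq_zero_of_entry_eq_zero`), and `G(2π) = 1`.
-/

/-! ### Lipschitz functions and almost everywhere derivatives -/

theorem norm_sub_le_of_ae_norm_deriv_le {f f' : ℝ → ℂ} {B B' : ℝ → ℝ} {a b : ℝ} (hab : a ≤ b)
    {K : NNReal} (hf : LipschitzOnWith K f (Set.Icc a b))
    (hf' : ∀ᵐ x ∂(volume.restrict (Set.Icc a b)), HasDerivAt f (f' x) x ∧ ‖f' x‖ ≤ B' x)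
    (hB : ∀ x, HasDerivAt B (B' x) x) (hB' : Continuous B') :
    ‖f b - f a‖ ≤ B b - B a := by
  set c : ℂ := f b - f a with hc
  rcases eq_or_ne c 0 with h0 | h0
  · rw [h0, norm_zero]
    have : ∫ x in a..b, B' x = B b - B a :=
      intervalIntegral.integral_eq_sub_of_hasDerivAt (fun x _ => hB x) (hB'.intervalIntegrable a b)
    rw [← this]
    refine intervalIntegral.integral_nonneg_of_ae_restrict hab ?_
    filter_upwards [hf'] with x hx using (norm_nonneg _).trans hx.2
  -- Projecting onto the direction of the increment `c` reduces to a real absolutely continuous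
  -- function, whose increment is `‖c‖ ^ 2`. One factor `‖c‖` is cancelled at the end, hence the
  -- separate case `c = 0`.
  let A : ℂ →L[ℝ] ℝ := Complex.reCLM.comp (ContinuousLinearMap.mul ℝ ℂ (star c))
  have hA : ∀ z, A z = (star c * z).re := fun z => rfl
  have hAle : ∀ z, A z ≤ ‖c‖ * ‖z‖ := fun z => by
    rw [hA]
    refine (Complex.re_le_norm _).trans ?_
    rw [norm_mul, norm_star]
  have hlip := A.lipschitz.comp_lipschitzOnWith hf
  rw [← Set.uIcc_of_le hab] at hlip
  have hac := hlip.absolutelyContinuousOnInterval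
  have hint := hac.integral_deriv_eq_sub
  have hle : ∫ x in a..b, deriv (A ∘ f) x ≤ ∫ x in a..b, ‖c‖ * B' x := by
    refine intervalIntegral.integral_mono_ae_restrict hab hac.intervalIntegrable_deriv
      ((hB'.intervalIntegrable a b).const_mul _) ?_
    filter_upwards [hf'] with x hx
    have h1 : HasDerivAt (A ∘ f) (A (f' x)) x := A.hasFDerivAt.comp_hasDerivAt x hx.1
    rw [h1.deriv]
    exact (hAle _).trans (mul_le_mul_of_nonneg_left hx.2 (norm_nonneg _))
  rw [hint, intervalIntegral.integral_const_mul,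
    intervalIntegral.integral_eq_sub_of_hasDerivAt (fun x _ => hB x)
      (hB'.intervalIntegrable a b)] at hle
  have h2 : (A ∘ f) b - (A ∘ f) a = ‖c‖ * ‖c‖ := by
    simp only [Function.comp]
    rw [← map_sub, ← hc, hA, Complex.star_def, ← Complex.normSq_eq_conj_mul_self,
      Complex.ofReal_re, Complex.normSq_eq_norm_sq, sq]
  rw [h2] at hle
  exact le_of_mul_le_mul_left hle (norm_pos_iff.mpr h0)

theorem norm_sub_le_of_ae_norm_deriv_le_const {f f' : ℝ → ℂ} {C : ℝ} {a b : ℝ} (hab : a ≤ b)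
    {K : NNReal} (hf : LipschitzOnWith K f (Set.Icc a b))
    (hf' : ∀ᵐ x ∂(volume.restrict (Set.Icc a b)), HasDerivAt f (f' x) x ∧ ‖f' x‖ ≤ C) :
    ‖f b - f a‖ ≤ C * (b - a) := by
  have := norm_sub_le_of_ae_norm_deriv_le (B := fun x => C * x) (B' := fun _ => C) hab hf hf'
    (fun x => by simpa using (hasDerivAt_id x).const_mul C) continuous_const
  linarith

theorem exists_lipschitzOnWith_Icc {f : ℝ → ℂ} (hf : LocallyLipschitz f) (a b : ℝ) :
    ∃ K, LipschitzOnWith K f (Set.Icc a b) :=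
  (hf.locallyLipschitzOn).exists_lipschitzOnWith_of_compact isCompact_Icc

theorem eq_of_ae_hasDerivAt_zero {f : ℝ → ℂ} (hf : LocallyLipschitz f)
    (hf' : ∀ᵐ x, HasDerivAt f 0 x) (x y : ℝ) : f x = f y := by
  wlog hxy : x ≤ y generalizing x y
  · exact (this y x (le_of_not_ge hxy)).symm
  obtain ⟨K, hK⟩ := exists_lipschitzOnWith_Icc hf x y
  have := norm_sub_le_of_ae_norm_deriv_le_const (f' := fun _ => 0) (C := 0) hxy hK
    (ae_restrict_of_ae (hf'.mono fun z hz => ⟨hz, by simp⟩))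
  simp only [zero_mul, norm_le_zero_iff, sub_eq_zero] at this
  exact this.symm

theorem locallyIntegrable_mul_of_bounded {α g : ℝ → ℂ} {C : ℝ} (hα : Measurable α)
    (hb : ∀ᵐ x, ‖α x‖ ≤ C) (hg : Continuous g) :
    LocallyIntegrable (fun x => α x * g x) volume :=
  fun x => by
    obtain ⟨s, hs, hi⟩ := hg.locallyIntegrable (μ := volume) x
    exact ⟨s, hs, Integrable.bdd_mul (c := C) hi hα.aestronglyMeasurable (ae_restrict_of_ae hb)⟩

theorem locallyLipschitz_integral_mul {α g : ℝ → ℂ} {C : ℝ} (hα : Measurable α)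
    (hb : ∀ᵐ x, ‖α x‖ ≤ C) (hg : Continuous g) :
    LocallyLipschitz (fun x => ∫ t in (0 : ℝ)..x, α t * g t) := by
  have hli := locallyIntegrable_mul_of_bounded hα hb hg
  have hii : ∀ x y, IntervalIntegrable (fun x => α x * g x) volume x y := fun x y =>
    intervalIntegrable_iff.mpr
      ((hli.integrableOn_isCompact isCompact_uIcc).mono_set Set.uIoc_subset_uIcc)
  intro x
  obtain ⟨M, hM⟩ := (isCompact_Icc (a := x - 1) (b := x + 1)).exists_bound_of_continuousOn
    hg.continuousOn
  refine ⟨Real.toNNReal (C * M), Set.Icc (x - 1) (x + 1),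
    Icc_mem_nhds (by linarith) (by linarith), ?_⟩
  refine LipschitzOnWith.of_dist_le_mul fun y hy z hz => ?_
  rw [dist_eq_norm, intervalIntegral.integral_interval_sub_left (hii _ _) (hii _ _),
    Real.dist_eq]
  have h1 : ‖∫ t in z..y, α t * g t‖ ≤ C * M * |y - z| := by
    refine intervalIntegral.norm_integral_le_of_norm_le_const_ae ?_
    filter_upwards [hb] with t ht htm
    have h3 := hM t (Set.uIcc_subset_Icc hz hy (Set.uIoc_subset_uIcc htm))
    rw [norm_mul]
    exact mul_le_mul ht h3 (norm_nonneg _) ((norm_nonneg _).trans ht)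
  exact h1.trans (mul_le_mul_of_nonneg_right (Real.le_coe_toNNReal _) (abs_nonneg _))

/-! ### Calculus of `HasLipschitzDeriv` in spaces without topology -/

section LipschitzDeriv

variable {M N : Type*} [AddCommGroup M] [Module ℂ M] [AddCommGroup N] [Module ℂ N]

theorem HasLipschitzDeriv.congr_ae {f f₁' f₂' : ℝ → M} (h : HasLipschitzDeriv f f₁')
    (he : ∀ᵐ x : ℝ, f₁' x = f₂' x) : HasLipschitzDeriv f f₂' := by
  obtain ⟨m, w, g, g', h1, h2, h3⟩ := h
  refine ⟨m, w, g, g', h1, h2, ?_⟩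
  filter_upwards [h3, he] with x hx hx' using ⟨hx.1, hx' ▸ hx.2⟩

theorem HasLipschitzDeriv.const (c : M) : HasLipschitzDeriv (fun _ => c) (fun _ => 0) := by
  refine ⟨1, fun _ => c, fun _ _ => 1, fun _ _ => 0, fun _ => LocallyLipschitz.const _, by simp, ?_⟩
  exact Filter.Eventually.of_forall fun x => ⟨fun _ => hasDerivAt_const _ _, by simp⟩

theorem HasLipschitzDeriv.add {f f' h h' : ℝ → M} (hf : HasLipschitzDeriv f f')
    (hh : HasLipschitzDeriv h h') :
    HasLipschitzDeriv (fun x => f x + h x) (fun x => f' x + h' x) := by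
  obtain ⟨m, w, g, g', h1, h2, h3⟩ := hf
  obtain ⟨n, u, k, k', h4, h5, h6⟩ := hh
  refine ⟨m + n, Fin.append w u, Fin.append g k, Fin.append g' k', ?_, ?_, ?_⟩
  · exact fun j => Fin.addCases (fun i => by simpa using h1 i) (fun i => by simpa using h4 i) j
  · intro x
    simp [Fin.sum_univ_add, h2, h5]
  · filter_upwards [h3, h6] with x hx hx'
    refine ⟨fun j => Fin.addCases (fun i => by simpa using hx.1 i)
      (fun i => by simpa using hx'.1 i) j, ?_⟩
    simp [Fin.sum_univ_add, hx.2, hx'.2]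

theorem HasLipschitzDeriv.map {f f' : ℝ → M} (hf : HasLipschitzDeriv f f') (L : M →ₗ[ℂ] N) :
    HasLipschitzDeriv (fun x => L (f x)) (fun x => L (f' x)) := by
  obtain ⟨m, w, g, g', h1, h2, h3⟩ := hf
  refine ⟨m, fun j => L (w j), g, g', h1, fun x => by simp [h2], ?_⟩
  filter_upwards [h3] with x hx using ⟨hx.1, by simp [hx.2]⟩

theorem HasLipschitzDeriv.sum {ι : Type*} (s : Finset ι) {f f' : ι → ℝ → M}
    (hf : ∀ i ∈ s, HasLipschitzDeriv (f i) (f' i)) :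
    HasLipschitzDeriv (fun x => ∑ i ∈ s, f i x) (fun x => ∑ i ∈ s, f' i x) := by
  classical
  induction s using Finset.induction_on with
  | empty => simpa using HasLipschitzDeriv.const (0 : M)
  | insert i s hi ih =>
    simp only [Finset.sum_insert hi]
    exact (hf i (Finset.mem_insert_self i s)).add
      (ih fun j hj => hf j (Finset.mem_insert_of_mem hj))

theorem HasLipschitzDeriv.sub {f f' h h' : ℝ → M} (hf : HasLipschitzDeriv f f')
    (hh : HasLipschitzDeriv h h') :
    HasLipschitzDeriv (fun x => f x - h x) (fun x => f' x - h' x) := by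
  simpa [sub_eq_add_neg] using hf.add (hh.map (-LinearMap.id))

theorem HasLipschitzDeriv.comp_add_const {f f' : ℝ → M} (hf : HasLipschitzDeriv f f') (T : ℝ) :
    HasLipschitzDeriv (fun x => f (x + T)) (fun x => f' (x + T)) := by
  obtain ⟨m, w, g, g', h1, h2, h3⟩ := hf
  refine ⟨m, w, fun j x => g j (x + T), fun j x => g' j (x + T), fun j => ?_, fun x => h2 _, ?_⟩
  · exact (h1 j).comp (LipschitzWith.id.add (LipschitzWith.const T)).locallyLipschitz
  · have := (measurePreserving_add_right (volume : Measure ℝ) T).quasiMeasurePreserving.ae h3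
    filter_upwards [this] with x hx
    exact ⟨fun j => (hx.1 j).comp_add_const x T, hx.2⟩

theorem HasLipschitzDeriv.scalar {f f' : ℝ → ℂ} (hf : HasLipschitzDeriv f f') :
    LocallyLipschitz f ∧ ∀ᵐ x, HasDerivAt f (f' x) x := by
  obtain ⟨m, w, g, g', h1, h2, h3⟩ := hf
  have hfe : f = fun x => ∑ j, g j x * w j := funext h2
  constructor
  · rw [hfe]
    have : ∀ s : Finset (Fin m), LocallyLipschitz fun x => ∑ j ∈ s, g j x * w j := by
      intro s
      classical
      induction s using Finset.induction_on with
      | empty => simpa using LocallyLipschitz.const (0 : ℂ)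
      | insert i s hi ih =>
        simp only [Finset.sum_insert hi]
        refine LocallyLipschitz.add ?_ ih
        exact ((ContinuousLinearMap.mul ℂ ℂ).flip (w i)).lipschitz.locallyLipschitz.comp (h1 i)
    exact this _
  · filter_upwards [h3] with x hx
    rw [hx.2, hfe]
    exact HasDerivAt.fun_sum fun j _ => (hx.1 j).mul_const (w j)

/-- Otherwise some linear functional vanishes on `W` but not on the increment; composed with `f` it
has zero derivative almost everywhere, so it is constant. This gives uniqueness (`W = ⊥`) and keeps
the coefficients of solutions homogeneous. -/
theorem HasLipschitzDeriv.sub_mem {f f' : ℝ → M} (hf : HasLipschitzDeriv f f')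
    (W : Submodule ℂ M) (hW : ∀ᵐ x, f' x ∈ W) (x y : ℝ) : f x - f y ∈ W := by
  by_contra hn
  obtain ⟨φ, hφ, hφW⟩ := W.exists_le_ker_of_notMem hn
  obtain ⟨h1, h2⟩ := (hf.map φ).scalar
  have h3 := eq_of_ae_hasDerivAt_zero h1 (by
    filter_upwards [h2, hW] with z hz hz'
    rwa [show φ (f' z) = 0 from hφW hz'] at hz) x y
  exact hφ (by rw [map_sub, h3, sub_self])

theorem HasLipschitzDeriv.eq_of_zero {f f' : ℝ → M} (hf : HasLipschitzDeriv f f')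
    (h0 : ∀ᵐ x, f' x = 0) (x y : ℝ) : f x = f y :=
  sub_eq_zero.mp (by simpa using hf.sub_mem ⊥ (by simpa using h0) x y)

theorem HasLipschitzDeriv.exists_primitive {f f' : ℝ → M} (hf : HasLipschitzDeriv f f')
    {α : ℝ → ℂ} {C : ℝ} (hα : Measurable α) (hb : ∀ᵐ x, ‖α x‖ ≤ C) (L : M →ₗ[ℂ] N) :
    ∃ h : ℝ → N, h 0 = 0 ∧ HasLipschitzDeriv h (fun x => α x • L (f x)) := by
  obtain ⟨m, w, g, g', h1, h2, h3⟩ := hf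
  refine ⟨fun x => ∑ j, (∫ t in (0 : ℝ)..x, α t * g j t) • L (w j), by simp, m, fun j => L (w j),
    fun j x => ∫ t in (0 : ℝ)..x, α t * g j t, fun j x => α x * g j x,
    fun j => locallyLipschitz_integral_mul hα hb (h1 j).continuous, fun x => rfl, ?_⟩
  have h4 : ∀ᵐ x, ∀ j, HasDerivAt (fun x => ∫ t in (0 : ℝ)..x, α t * g j t) (α x * g j x) x := by
    refine ae_all_iff.mpr fun j => ?_
    filter_upwards [LocallyIntegrable.ae_hasDerivAt_integral
      (locallyIntegrable_mul_of_bounded hα hb (h1 j).continuous)] with x hx using hx 0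
  filter_upwards [h4] with x hx
  exact ⟨hx, by simp [h2, Finset.smul_sum, mul_smul]⟩

end LipschitzDeriv

theorem locallyLipschitz_mul {f g : ℝ → ℂ} (hf : LocallyLipschitz f) (hg : LocallyLipschitz g) :
    LocallyLipschitz (fun x => f x * g x) :=
  ((contDiff_fst.mul contDiff_snd : ContDiff ℝ 1 fun p : ℂ × ℂ => p.1 * p.2).locallyLipschitz).comp
    (hf.prodMk hg)

theorem HasLipschitzDeriv.smul_const {M : Type*} [AddCommGroup M] [Module ℂ M] {g g' : ℝ → ℂ}
    (hg : LocallyLipschitz g) (hg' : ∀ᵐ x, HasDerivAt g (g' x) x) (w : M) :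
    HasLipschitzDeriv (fun x => g x • w) (fun x => g' x • w) := by
  refine ⟨1, fun _ => w, fun _ => g, fun _ => g', fun _ => hg, by simp, ?_⟩
  filter_upwards [hg'] with x hx using ⟨fun _ => hx, by simp⟩

theorem HasLipschitzDeriv.mul {A : Type*} [Ring A] [Algebra ℂ A] {f f' h h' : ℝ → A}
    (hf : HasLipschitzDeriv f f') (hh : HasLipschitzDeriv h h') :
    HasLipschitzDeriv (fun x => f x * h x) (fun x => f' x * h x + f x * h' x) := by
  obtain ⟨m, w, g, g', h1, h2, h3⟩ := hf
  obtain ⟨n, u, k, k', h4, h5, h6⟩ := hh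
  have key := HasLipschitzDeriv.sum Finset.univ (fun i _ => HasLipschitzDeriv.sum Finset.univ
    (fun j _ => HasLipschitzDeriv.smul_const (locallyLipschitz_mul (h1 i) (h4 j))
      (g' := fun x => g' i x * k j x + g i x * k' j x)
      (by filter_upwards [h3, h6] with x hx hx' using (hx.1 i).mul (hx'.1 j)) (w i * u j)))
  have he : (fun x => f x * h x) = fun x => ∑ i, ∑ j, (g i x * k j x) • (w i * u j) := by
    funext x
    simp only [h2, h5, Finset.sum_mul_sum, smul_mul_smul_comm]
  rw [he]
  refine key.congr_ae ?_
  filter_upwards [h3, h6] with x hx hx'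
  rw [hx.2, hx'.2, h2, h5]
  simp only [Finset.sum_mul_sum, smul_mul_smul_comm, ← Finset.sum_add_distrib, add_smul]

/-! ### Triangular linear systems and iterated integrals -/

section Recursion

variable {M : Type*} [AddCommGroup M] [Module ℂ M]

open Classical in
/-- A primitive of `α • L f` vanishing at `0`, if there is one. -/
def primitive (α : ℝ → ℂ) (L : M →ₗ[ℂ] M) (f : ℝ → M) : ℝ → M :=
  if h : ∃ h : ℝ → M, h 0 = 0 ∧ HasLipschitzDeriv h (fun x => α x • L (f x)) then h.choose else 0

theorem primitive_spec {α : ℝ → ℂ} {C : ℝ} (hα : Measurable α) (hb : ∀ᵐ x, ‖α x‖ ≤ C)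
    (L : M →ₗ[ℂ] M) {f f' : ℝ → M} (hf : HasLipschitzDeriv f f') :
    primitive α L f 0 = 0 ∧ HasLipschitzDeriv (primitive α L f) (fun x => α x • L (f x)) := by
  have h := hf.exists_primitive hα hb L
  rw [primitive, dif_pos h]
  exact h.choose_spec

/-- The iterated integrals solving `f_{n+1}' = ∑_{i+j=n} α_i L_i f_j`, `f_0 = c`,
`f_{n+1}(0) = 0`. -/
def iteratedSolution (α : ℕ → ℝ → ℂ) (L : ℕ → M →ₗ[ℂ] M) (c : M) : ℕ → ℝ → M
  | 0 => fun _ => c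
  | n + 1 => fun x => ∑ j : Fin (n + 1),
      primitive (α (n - j)) (L (n - j)) (iteratedSolution α L c j) x

variable {α : ℕ → ℝ → ℂ} {C : ℕ → ℝ}

/-- Strong induction shows that every earlier term has a Lipschitz derivative, so the default branch
of `primitive` is never taken. -/
theorem iteratedSolution_spec (hα : ∀ i, Measurable (α i)) (hb : ∀ i, ∀ᵐ x, ‖α i x‖ ≤ C i)
    (L : ℕ → M →ₗ[ℂ] M) (c : M) (n : ℕ) :
    iteratedSolution α L c (n + 1) 0 = 0 ∧
      HasLipschitzDeriv (iteratedSolution α L c (n + 1))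
        (fun x => ∑ p ∈ Finset.HasAntidiagonal.antidiagonal n, α p.1 x • L p.1 (iteratedSolution α L c p.2 x)) := by
  induction n using Nat.strong_induction_on with
  | _ n ih =>
    have hd : ∀ j : Fin (n + 1), ∃ f', HasLipschitzDeriv (iteratedSolution α L c j) f' := by
      rintro ⟨j, hj⟩
      cases j with
      | zero =>
        refine ⟨fun _ => 0, ?_⟩
        simp only [iteratedSolution]
        exact HasLipschitzDeriv.const c
      | succ j => exact ⟨_, (ih j (by omega)).2⟩
    have hp := fun j : Fin (n + 1) =>
      primitive_spec (hα (n - j)) (hb (n - j)) (L (n - j)) (hd j).choose_spec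
    constructor
    · rw [iteratedSolution]
      exact Finset.sum_eq_zero fun j _ => (hp j).1
    · have h1 := HasLipschitzDeriv.sum Finset.univ fun j _ => (hp j).2
      have h2 : iteratedSolution α L c (n + 1) = fun x => ∑ j : Fin (n + 1),
          primitive (α (n - j)) (L (n - j)) (iteratedSolution α L c j) x := by
        rw [iteratedSolution]
      rw [h2]
      convert h1 using 2 with x
      rw [Finset.Nat.antidiagonal_eq_map', Finset.sum_map, Finset.sum_range]
      rfl

end Recursion

/-! ### Coefficients on the circle lifted to the line -/

/-- The coefficients `a_{i+1}` as periodic functions, indexed by `i : ℕ`. -/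
def coef (a : ℕ+ → LInfty) (i : ℕ) (x : ℝ) : ℂ := val a i.succPNat x

theorem coef_periodic (a : ℕ+ → LInfty) (i : ℕ) (x : ℝ) :
    coef a i (x + 2 * Real.pi) = coef a i x := by
  simp [coef, val]

theorem measurable_coef (a : ℕ+ → LInfty) (i : ℕ) : Measurable (coef a i) :=
  (Lp.stronglyMeasurable (a i.succPNat)).measurable.comp (AddCircle.measurable_mk')

/-- The line is a countable union of half-open periods, each mapped to the circle by a
measure-preserving map. -/
theorem ae_real_of_ae_circ {p : Circ → Prop} (h : ∀ᵐ y, p y) : ∀ᵐ x : ℝ, p (x : Circ) := by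
  have h1 : ∀ n : ℤ, ∀ᵐ x ∂(volume.restrict (Set.Ioc (n • (2 * Real.pi))
      (n • (2 * Real.pi) + 2 * Real.pi))), p ((x : ℝ) : Circ) := fun n =>
    (AddCircle.measurePreserving_mk (2 * Real.pi) _).quasiMeasurePreserving.ae h
  rw [← Measure.restrict_univ (μ := (volume : Measure ℝ)),
    ← iUnion_Ioc_zsmul (p := 2 * Real.pi) Real.two_pi_pos, ae_restrict_iUnion_iff]
  intro n
  convert h1 n using 3
  rw [add_zsmul, one_zsmul]

theorem ae_norm_coef_le {a : ℕ+ → LInfty} {l : ℝ} (hl : ∀ i : ℕ+, ‖a i‖ ≤ l ^ (i : ℕ)) :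
    ∀ᵐ x, ∀ i, ‖coef a i x‖ ≤ l ^ (i + 1) := by
  refine ae_all_iff.mpr fun i => ?_
  have h1 : ∀ᵐ y, ‖a i.succPNat y‖ ≤ l ^ (i + 1) := by
    filter_upwards [ae_le_eLpNormEssSup (f := a i.succPNat) (μ := volume)] with y hy
    refine le_trans ?_ (hl i.succPNat)
    rw [Lp.norm_def, eLpNorm_exponent_top]
    rw [← toReal_enorm]
    refine ENNReal.toReal_mono ?_ hy
    rw [← eLpNorm_exponent_top]
    exact Lp.eLpNorm_ne_top _
  exact ae_real_of_ae_circ (p := fun y => ‖a i.succPNat y‖ ≤ l ^ (i + 1)) h1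

/-! ### The linear equation, its fundamental solution and its inverse -/

section Linear

variable (a : ℕ+ → LInfty) (x : ℝ)

@[simp] theorem coeff_omega_zero : PowerSeries.coeff 0 (omega a x) = 0 := by
  simp [omega]

@[simp] theorem coeff_omega_succ (n : ℕ) :
    PowerSeries.coeff (n + 1) (omega a x) = coef a n x • (S₁ * S₂ ^ n) := by
  simp [omega, coef, Nat.succPNat]

theorem coeff_zero_omega_mul (P : PowerSeries Alg) :
    PowerSeries.coeff 0 (omega a x * P) = 0 := by
  simp [PowerSeries.coeff_mul]

theorem coeff_succ_omega_mul (P : PowerSeries Alg) (n : ℕ) :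
    PowerSeries.coeff (n + 1) (omega a x * P) =
      ∑ p ∈ Finset.HasAntidiagonal.antidiagonal n,
        coef a p.1 x • (S₁ * S₂ ^ p.1 * PowerSeries.coeff p.2 P) := by
  rw [PowerSeries.coeff_mul, Finset.Nat.antidiagonal_succ]
  simp

theorem coeff_zero_mul_omega (P : PowerSeries Alg) :
    PowerSeries.coeff 0 (P * omega a x) = 0 := by
  simp [PowerSeries.coeff_mul]

theorem coeff_succ_mul_omega (P : PowerSeries Alg) (n : ℕ) :
    PowerSeries.coeff (n + 1) (P * omega a x) =
      ∑ p ∈ Finset.HasAntidiagonal.antidiagonal n,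
        coef a p.1 x • (PowerSeries.coeff p.2 P * (S₁ * S₂ ^ p.1)) := by
  rw [PowerSeries.coeff_mul, Finset.Nat.antidiagonal_succ',
    ← Finset.Nat.sum_antidiagonal_swap (n := n)]
  simp

theorem omega_periodic : omega a (x + 2 * Real.pi) = omega a x := by
  ext n
  cases n <;> simp [coef_periodic]

end Linear

/-- The product rule gives `(GF)' = -GwF + GwF = 0`, read coefficientwise. -/
theorem HasLipschitzDeriv.coeff_mul_of_linear {A : Type*} [Ring A] [Algebra ℂ A]
    {F G w : ℝ → PowerSeries A}
    (hF : ∀ n, HasLipschitzDeriv (fun x => PowerSeries.coeff n (F x))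
      (fun x => PowerSeries.coeff n (w x * F x)))
    (hG : ∀ n, HasLipschitzDeriv (fun x => PowerSeries.coeff n (G x))
      (fun x => -PowerSeries.coeff n (G x * w x))) (n : ℕ) :
    HasLipschitzDeriv (fun x => PowerSeries.coeff n (G x * F x)) (fun _ => 0) := by
  have h1 := HasLipschitzDeriv.sum (Finset.HasAntidiagonal.antidiagonal n) fun p _ =>
    (hG p.1).mul (hF p.2)
  simp only [PowerSeries.coeff_mul (n := n)]
  refine h1.congr_ae (Filter.Eventually.of_forall fun x => ?_)
  simp only [Finset.sum_add_distrib, neg_mul, Finset.sum_neg_distrib]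
  rw [← PowerSeries.coeff_mul, ← PowerSeries.coeff_mul, mul_assoc, neg_add_cancel]

theorem isUnit_of_coeff_zero_eq_one {P : PowerSeries Alg} (h : PowerSeries.coeff 0 P = 1) :
    IsUnit P := by
  rw [PowerSeries.isUnit_iff_constantCoeff, ← PowerSeries.coeff_zero_eq_constantCoeff_apply, h]
  exact isUnit_one

/-- The solution of `F' = ω F` with `F(0) = 1`. -/
def leftSolution (a : ℕ+ → LInfty) (x : ℝ) : PowerSeries Alg :=
  PowerSeries.mk fun n =>
    iteratedSolution (coef a) (fun i => LinearMap.mulLeft ℂ (S₁ * S₂ ^ i)) 1 n x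

/-- The solution of `G' = -G ω` with `G(0) = 1`, which is the inverse of `leftSolution`. -/
def rightSolution (a : ℕ+ → LInfty) (x : ℝ) : PowerSeries Alg :=
  PowerSeries.mk fun n =>
    iteratedSolution (coef a) (fun i => -LinearMap.mulRight ℂ (S₁ * S₂ ^ i)) 1 n x

theorem coeff_zero_leftSolution (a : ℕ+ → LInfty) (x : ℝ) :
    PowerSeries.coeff 0 (leftSolution a x) = 1 := by
  simp [leftSolution, iteratedSolution]

theorem coeff_zero_rightSolution (a : ℕ+ → LInfty) (x : ℝ) :
    PowerSeries.coeff 0 (rightSolution a x) = 1 := by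
  simp [rightSolution, iteratedSolution]

section Solutions

variable {a : ℕ+ → LInfty} (ha : a ∈ coeffSpace)
include ha

theorem exists_ae_norm_coef_le : ∃ C : ℕ → ℝ, ∀ i, ∀ᵐ x, ‖coef a i x‖ ≤ C i := by
  obtain ⟨l, -, hl⟩ := ha
  exact ⟨_, ae_all_iff.mp (ae_norm_coef_le hl)⟩

theorem leftSolution_zero : leftSolution a 0 = 1 := by
  obtain ⟨C, hC⟩ := exists_ae_norm_coef_le ha
  ext n
  cases n with
  | zero => simp [coeff_zero_leftSolution]
  | succ n =>
    rw [leftSolution, PowerSeries.coeff_mk,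
      (iteratedSolution_spec (measurable_coef a) hC _ _ n).1, PowerSeries.coeff_one,
      if_neg n.succ_ne_zero]

theorem rightSolution_zero : rightSolution a 0 = 1 := by
  obtain ⟨C, hC⟩ := exists_ae_norm_coef_le ha
  ext n
  cases n with
  | zero => simp [coeff_zero_rightSolution]
  | succ n =>
    rw [rightSolution, PowerSeries.coeff_mk,
      (iteratedSolution_spec (measurable_coef a) hC _ _ n).1, PowerSeries.coeff_one,
      if_neg n.succ_ne_zero]

theorem hasLipschitzDeriv_leftSolution (n : ℕ) :
    HasLipschitzDeriv (fun x => PowerSeries.coeff n (leftSolution a x))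
      (fun x => PowerSeries.coeff n (omega a x * leftSolution a x)) := by
  obtain ⟨C, hC⟩ := exists_ae_norm_coef_le ha
  cases n with
  | zero =>
    simp only [coeff_zero_leftSolution, coeff_zero_omega_mul]
    exact HasLipschitzDeriv.const 1
  | succ n =>
    simp only [coeff_succ_omega_mul, leftSolution, PowerSeries.coeff_mk]
    exact (iteratedSolution_spec (measurable_coef a) hC
      (fun i => LinearMap.mulLeft ℂ (S₁ * S₂ ^ i)) 1 n).2

theorem hasLipschitzDeriv_rightSolution (n : ℕ) :
    HasLipschitzDeriv (fun x => PowerSeries.coeff n (rightSolution a x))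
      (fun x => -PowerSeries.coeff n (rightSolution a x * omega a x)) := by
  obtain ⟨C, hC⟩ := exists_ae_norm_coef_le ha
  cases n with
  | zero =>
    simp only [coeff_zero_rightSolution, coeff_zero_mul_omega, neg_zero]
    exact HasLipschitzDeriv.const 1
  | succ n =>
    simp only [coeff_succ_mul_omega, rightSolution, PowerSeries.coeff_mk]
    convert (iteratedSolution_spec (measurable_coef a) hC
      (fun i => -LinearMap.mulRight ℂ (S₁ * S₂ ^ i)) 1 n).2 using 2 with x
    rw [← Finset.sum_neg_distrib]
    refine Finset.sum_congr rfl fun p _ => ?_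
    rw [LinearMap.neg_apply, smul_neg]
    rfl

theorem rightSolution_mul_leftSolution (x : ℝ) : rightSolution a x * leftSolution a x = 1 := by
  ext n
  have h1 := HasLipschitzDeriv.coeff_mul_of_linear (hasLipschitzDeriv_leftSolution ha)
    (hasLipschitzDeriv_rightSolution ha) n
  have h2 := h1.eq_of_zero (Filter.Eventually.of_forall fun _ => rfl) x 0
  simpa [leftSolution_zero ha, rightSolution_zero ha] using h2

end Solutions

/-! ### Uniqueness and monodromy -/

/-- `leftSolution` as a map to the group of invertible formal power series. -/
def fundamentalSolution (a : ℕ+ → LInfty) (x : ℝ) : (PowerSeries Alg)ˣ :=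
  (isUnit_of_coeff_zero_eq_one (coeff_zero_leftSolution a x)).unit

@[simp] theorem coe_fundamentalSolution (a : ℕ+ → LInfty) (x : ℝ) :
    (fundamentalSolution a x : PowerSeries Alg) = leftSolution a x := rfl

theorem isFundamentalSolution {a : ℕ+ → LInfty} (ha : a ∈ coeffSpace) :
    IsFundamentalSolution a (fundamentalSolution a) where
  init := Units.ext (leftSolution_zero ha)
  ode := hasLipschitzDeriv_leftSolution ha

/-- Coefficient `n + 1` of `ωF` involves only coefficients of `F` up to `n`, so by induction the
difference of the two solutions has zero derivative. -/
theorem IsFundamentalSolution.unique {a : ℕ+ → LInfty} {F F' : ℝ → (PowerSeries Alg)ˣ}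
    (hF : IsFundamentalSolution a F) (hF' : IsFundamentalSolution a F') : F = F' := by
  have key : ∀ n x, PowerSeries.coeff n (F x : PowerSeries Alg) =
      PowerSeries.coeff n (F' x : PowerSeries Alg) := by
    intro n
    induction n using Nat.strong_induction_on with
    | _ n ih =>
      intro x
      have h := ((hF.ode n).sub (hF'.ode n)).eq_of_zero (Filter.Eventually.of_forall fun y => by
        cases n with
        | zero => simp only [coeff_zero_omega_mul, sub_zero]
        | succ n =>
          simp only [coeff_succ_omega_mul, sub_eq_zero]
          refine Finset.sum_congr rfl fun p hp => ?_
          rw [ih p.2 (by have := Finset.HasAntidiagonal.mem_antidiagonal.mp hp; omega) y]) x 0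
      rw [hF.init, hF'.init, sub_self] at h
      exact sub_eq_zero.mp h
  funext x
  exact Units.ext (PowerSeries.ext fun n => key n x)

/-- By periodicity of `ω`, `F(x + 2π) F(2π)⁻¹` is again a fundamental solution. -/
theorem IsFundamentalSolution.add_two_pi {a : ℕ+ → LInfty} {F : ℝ → (PowerSeries Alg)ˣ}
    (hF : IsFundamentalSolution a F) (x : ℝ) :
    F (x + 2 * Real.pi) = F x * F (2 * Real.pi) := by
  have h : IsFundamentalSolution a fun x => F (x + 2 * Real.pi) * (F (2 * Real.pi))⁻¹ := by
    refine ⟨by simp, fun n => ?_⟩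
    simp only [Units.val_mul, ← mul_assoc]
    simp only [PowerSeries.coeff_mul (ψ := (((F (2 * Real.pi))⁻¹ : (PowerSeries Alg)ˣ) :
      PowerSeries Alg))]
    refine HasLipschitzDeriv.sum _ fun p _ => ?_
    have h1 := ((hF.ode p.1).comp_add_const (2 * Real.pi)).map (LinearMap.mulRight ℂ
      (PowerSeries.coeff p.2 (((F (2 * Real.pi))⁻¹ : (PowerSeries Alg)ˣ) : PowerSeries Alg)))
    simp only [omega_periodic] at h1
    exact h1
  have h2 := congrFun (h.unique hF) x
  rw [← h2, inv_mul_cancel_right]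

theorem IsFundamentalSolution.two_pi_mul_int {a : ℕ+ → LInfty} {F : ℝ → (PowerSeries Alg)ˣ}
    (hF : IsFundamentalSolution a F) (n : ℤ) :
    F (2 * Real.pi * n) = F (2 * Real.pi) ^ n := by
  induction n with
  | zero => simp [hF.init]
  | succ n ih =>
    rw [zpow_add_one, ← ih, ← hF.add_two_pi]
    push_cast
    ring_nf
  | pred n ih =>
    rw [zpow_sub_one, eq_mul_inv_iff_mul_eq, ← ih, ← hF.add_two_pi]
    push_cast
    ring_nf

/-! ### The representation by differentiation and shift -/

/-- Termwise differentiation of the sequence of Taylor coefficients. -/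
def derivOp : Module.End ℂ (ℕ → ℂ) where
  toFun f m := (m + 1) * f (m + 1)
  map_add' f g := by ext m; simp [mul_add]
  map_smul' c f := by ext m; simp [mul_left_comm]

/-- The shift of sequences. -/
def shiftOp : Module.End ℂ (ℕ → ℂ) where
  toFun f m := f (m + 1)
  map_add' _ _ := rfl
  map_smul' _ _ := rfl

/-- The representation of the algebra in which `S₁` is differentiation and `S₂` is the shift. -/
def rep : Alg →ₐ[ℂ] Module.End ℂ (ℕ → ℂ) :=
  RingQuot.liftAlgHom ℂ ⟨FreeAlgebra.lift ℂ ![derivOp, shiftOp], by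
    rintro _ _ ⟨⟩
    ext f m
    simp [derivOp, shiftOp, sq]
    ring⟩

theorem rep_S₁ : rep S₁ = derivOp := by
  simp [rep, S₁]

theorem rep_S₂ : rep S₂ = shiftOp := by
  simp [rep, S₂]

theorem rep_S₂_pow_apply (i : ℕ) (f : ℕ → ℂ) (m : ℕ) : rep (S₂ ^ i) f m = f (m + i) := by
  induction i generalizing m with
  | zero => simp
  | succ i ih =>
    rw [pow_succ', map_mul, Module.End.mul_apply, rep_S₂]
    change rep (S₂ ^ i) f (m + 1) = _
    rw [ih, add_assoc, add_comm 1]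

theorem rep_S₁_pow_apply (i : ℕ) (f : ℕ → ℂ) (m : ℕ) :
    rep (S₁ ^ i) f m = (ascPochhammer ℂ i).eval (m + 1 : ℂ) * f (m + i) := by
  induction i generalizing m with
  | zero => simp
  | succ i ih =>
    rw [pow_succ', map_mul, Module.End.mul_apply, rep_S₁]
    change (m + 1 : ℂ) * rep (S₁ ^ i) f (m + 1) = _
    rw [ih, ascPochhammer_succ_left]
    simp only [Polynomial.eval_mul, Polynomial.eval_X, Polynomial.eval_comp, Polynomial.eval_add,
      Polynomial.eval_one]
    push_cast
    rw [add_assoc m, add_comm 1 i]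
    ring

/-- The matrix entry at `(m, n + m)` of the representation. -/
def entry (n m : ℕ) : Alg →ₗ[ℂ] ℂ :=
  (LinearMap.proj m).comp ((LinearMap.applyₗ (Pi.single (n + m) 1)).comp rep.toLinearMap)

theorem entry_apply (n m : ℕ) (g : Alg) : entry n m g = rep g (Pi.single (n + m) 1) m := rfl

theorem rep_S₁_mul_S₂_pow_single (i n : ℕ) :
    rep (S₁ * S₂ ^ i) (Pi.single (n + i + 1) (1 : ℂ)) = (n + 1 : ℂ) • Pi.single n 1 := by
  rw [map_mul, Module.End.mul_apply, rep_S₁]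
  ext m
  change (m + 1 : ℂ) * rep (S₂ ^ i) _ (m + 1) = _
  rw [rep_S₂_pow_apply]
  by_cases h : m = n
  · subst h
    rw [show m + 1 + i = m + i + 1 by ring]
    simp
  · rw [Pi.single_eq_of_ne (by omega)]
    simp [Pi.single_eq_of_ne h]

/-- In a product the right factor acts first, and `S₁ S₂ ^ i` sends a basis sequence to a multiple
of a single one. Hence right multiplication by `ω` yields a closed scalar recursion for each `m`;
this is why the inverse solution is used. -/
theorem entry_mul (i j m : ℕ) (g : Alg) :
    entry (i + j + 1) m (g * (S₁ * S₂ ^ i)) = (j + m + 1 : ℂ) * entry j m g := by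
  rw [entry_apply, map_mul, Module.End.mul_apply,
    show i + j + 1 + m = (j + m) + i + 1 by ring, rep_S₁_mul_S₂_pow_single, map_smul,
    Pi.smul_apply, entry_apply, smul_eq_mul]
  push_cast
  rfl

theorem entry_zero_one (m : ℕ) : entry 0 m 1 = 1 := by
  simp [entry_apply]

/-! ### Ordered monomials and faithfulness on homogeneous elements -/

/-- Normal ordering: it makes right multiplication by `S₁` preserve spans of ordered monomials while
raising the degree by one. -/
theorem S₂_pow_mul_S₁ (b : ℕ) : S₂ ^ b * S₁ = S₁ * S₂ ^ b + (b : ℂ) • S₂ ^ (b + 1) := by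
  have h : S₂ * S₁ = S₁ * S₂ + S₂ ^ 2 := by
    have h1 : S₁ * S₂ - S₂ * S₁ = -S₂ ^ 2 := by
      have := RingQuot.mkAlgHom_rel ℂ Rel.comm
      simpa [S₁, S₂] using this
    rw [sub_eq_iff_eq_add.mp h1]
    abel
  induction b with
  | zero => simp
  | succ b ih =>
    rw [pow_succ', mul_assoc, ih, mul_add, ← mul_assoc, h, add_mul, mul_smul_comm]
    push_cast
    rw [add_smul, one_smul, ← pow_succ', mul_assoc, ← pow_succ', ← pow_add]
    rw [add_assoc, add_comm (S₂ ^ (2 + b)), show 2 + b = b + 1 + 1 by ring]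

/-- The span of the ordered monomials of degree `n`. -/
def homogeneous (n : ℕ) : Submodule ℂ Alg :=
  Submodule.span ℂ (Set.range fun p : Finset.range (n + 1) => S₁ ^ (p : ℕ) * S₂ ^ (n - p))

theorem monomial_mem_homogeneous (i j : ℕ) : S₁ ^ i * S₂ ^ j ∈ homogeneous (i + j) := by
  refine Submodule.subset_span ⟨⟨i, by simp⟩, ?_⟩
  simp

theorem mul_S₂_mem {n : ℕ} {g : Alg} (hg : g ∈ homogeneous n) (i : ℕ) :
    g * S₂ ^ i ∈ homogeneous (n + i) := by
  refine Submodule.span_induction (p := fun g _ => g * S₂ ^ i ∈ homogeneous (n + i))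
    ?_ ?_ ?_ ?_ hg
  · rintro _ ⟨⟨a, ha⟩, rfl⟩
    have ha' : a ≤ n := by simpa [Nat.lt_succ_iff] using ha
    have := monomial_mem_homogeneous a (n - a + i)
    rw [show a + (n - a + i) = n + i by omega, pow_add, ← mul_assoc] at this
    exact this
  · simp
  · intro x y _ _ hx hy
    rw [add_mul]; exact add_mem hx hy
  · intro c x _ hx
    rw [smul_mul_assoc]; exact Submodule.smul_mem _ _ hx

theorem mul_S₁_mem {n : ℕ} {g : Alg} (hg : g ∈ homogeneous n) : g * S₁ ∈ homogeneous (n + 1) := by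
  refine Submodule.span_induction (p := fun g _ => g * S₁ ∈ homogeneous (n + 1)) ?_ ?_ ?_ ?_ hg
  · rintro _ ⟨⟨a, ha⟩, rfl⟩
    have ha' : a ≤ n := by simpa [Nat.lt_succ_iff] using ha
    have h1 := monomial_mem_homogeneous (a + 1) (n - a)
    have h2 := monomial_mem_homogeneous a (n - a + 1)
    rw [show a + 1 + (n - a) = n + 1 by omega] at h1
    rw [show a + (n - a + 1) = n + 1 by omega] at h2
    have h3 := add_mem h1 (Submodule.smul_mem _ ((n - a : ℕ) : ℂ) h2)
    convert h3 using 1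
    change S₁ ^ a * S₂ ^ (n - a) * S₁ = _
    rw [mul_assoc, S₂_pow_mul_S₁, mul_add, ← mul_assoc, ← pow_succ, mul_smul_comm]
  · simp
  · intro x y _ _ hx hy
    rw [add_mul]; exact add_mem hx hy
  · intro c x _ hx
    rw [smul_mul_assoc]; exact Submodule.smul_mem _ _ hx

theorem entry_monomial (i j m : ℕ) :
    entry (i + j) m (S₁ ^ i * S₂ ^ j) = (ascPochhammer ℂ i).eval (m + 1 : ℂ) := by
  rw [entry_apply, map_mul, Module.End.mul_apply, rep_S₁_pow_apply, rep_S₂_pow_apply,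
    show m + i + j = i + j + m by ring]
  simp

/-- The representation is faithful on homogeneous elements. -/
theorem eq_zero_of_entry_eq_zero {n : ℕ} {g : Alg} (hg : g ∈ homogeneous n)
    (h : ∀ m, entry n m g = 0) : g = 0 := by
  rw [homogeneous, Submodule.mem_span_range_iff_exists_fun] at hg
  obtain ⟨c, rfl⟩ := hg
  -- The rising factorials contain one polynomial of each degree, hence are linearly independent. By
  -- `entry_monomial` the hypothesis says that their combination with coefficients `c` vanishes at
  -- every `m + 1`.
  let S : Polynomial.Sequence ℂ := ⟨fun i => ascPochhammer ℂ i, fun i => by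
    rw [Polynomial.degree_eq_natDegree (monic_ascPochhammer ℂ i).ne_zero,
      ascPochhammer_natDegree]⟩
  have hS : ∑ p : Finset.range (n + 1), c p • S (p : ℕ) = 0 := by
    refine Polynomial.eq_zero_of_infinite_isRoot _
      ((Set.infinite_range_of_injective (f := fun m : ℕ => (m + 1 : ℂ)) ?_).mono ?_)
    · intro x y hxy
      simpa using hxy
    · rintro _ ⟨m, rfl⟩
      have h1 := h m
      rw [map_sum] at h1
      simp only [Set.mem_ofPred_eq, Polynomial.IsRoot.def, Polynomial.eval_finsetSum,
        Polynomial.eval_smul, ← h1]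
      refine Finset.sum_congr rfl fun p _ => ?_
      have hp : (p : ℕ) ≤ n := Nat.lt_succ_iff.mp (Finset.mem_range.mp p.2)
      have h2 := entry_monomial p (n - p) m
      rw [Nat.add_sub_cancel' hp] at h2
      rw [map_smul, h2]
  have hc := (Fintype.linearIndependent_iff.mp
    (S.linearIndependent.comp (fun p : Finset.range (n + 1) => (p : ℕ)) Subtype.val_injective)) c hS
  simp [hc]

/-! ### Formal first integrals and their convergence -/

section FirstIntegral

variable {α : ℕ → ℝ → ℂ} {l : ℝ}

/-- Summation over a triangle, by antidiagonals and by rows. It matches the terms from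
differentiating the `d_n` with truncations of those from differentiating the powers of `v`. -/
theorem sum_antidiagonal_mul_pow_succ {R : Type*} [CommRing R] (A D : ℕ → R) (z : R) (m N : ℕ) :
    ∑ n ∈ Finset.range N, (∑ p ∈ Finset.HasAntidiagonal.antidiagonal n,
        (p.2 + m + 1 : R) * A p.1 * D p.2) * z ^ (n + 1 + m + 1) =
      ∑ j ∈ Finset.range (N + 1), (j + m + 1 : R) * D j * z ^ (j + m) *
        ∑ i ∈ Finset.range (N - j), A i * z ^ (i + 2) := by
  induction N with
  | zero => simp
  | succ N ih =>
    rw [Finset.sum_range_succ, ih, Finset.sum_range_succ _ (N + 1)]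
    have h1 : ∑ j ∈ Finset.range (N + 1), (j + m + 1 : R) * D j * z ^ (j + m) *
        ∑ i ∈ Finset.range (N + 1 - j), A i * z ^ (i + 2) =
        ∑ j ∈ Finset.range (N + 1), ((j + m + 1 : R) * D j * z ^ (j + m) *
          ∑ i ∈ Finset.range (N - j), A i * z ^ (i + 2) +
          (j + m + 1 : R) * A (N - j) * D j * z ^ (N + 1 + m + 1)) := by
      refine Finset.sum_congr rfl fun j hj => ?_
      have hj' : j ≤ N := Nat.lt_succ_iff.mp (Finset.mem_range.mp hj)
      rw [Nat.succ_sub hj', Finset.sum_range_succ]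
      obtain ⟨k, rfl⟩ := Nat.exists_eq_add_of_le hj'
      rw [Nat.add_sub_cancel_left]
      ring
    rw [h1, Finset.sum_add_distrib, Finset.Nat.antidiagonal_eq_map', Finset.sum_map]
    simp only [Finset.sum_mul, Nat.sub_self, Finset.range_zero, Finset.sum_empty, mul_zero,
      add_zero]
    rfl

/-- `d` is the sequence of coefficients of a formal first integral `∑ d_n(x) v^{n+m+1}` of
`v' = ∑ α_i v^{i+2}` with `d_n(0) = δ_{n0}`. -/
structure IsFirstIntegral (α : ℕ → ℝ → ℂ) (m : ℕ) (d : ℕ → ℝ → ℂ) : Prop where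
  zero : ∀ x, d 0 x = 1
  init : ∀ n, d (n + 1) 0 = 0
  lipschitz : ∀ n, LocallyLipschitz (d n)
  ode : ∀ᵐ x, ∀ n, HasDerivAt (d (n + 1))
    (-∑ p ∈ Finset.HasAntidiagonal.antidiagonal n, (p.2 + m + 1 : ℂ) * α p.1 x * d p.2 x) x

theorem sum_range_succ_mul_two_pow_le (n m : ℕ) :
    ∑ j ∈ Finset.range (n + 1), (j + m + 1 : ℝ) * 2 ^ j ≤ (m + 1) * (n + 1) * 2 ^ (n + 1) := by
  have h1 : ∀ j ∈ Finset.range (n + 1), (j + m + 1 : ℝ) * 2 ^ j ≤ (m + 1) * (n + 1) * 2 ^ j := by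
    intro j hj
    have hj' : (j : ℝ) ≤ n := by exact_mod_cast Nat.lt_succ_iff.mp (Finset.mem_range.mp hj)
    have : (j + m + 1 : ℝ) ≤ (m + 1) * (n + 1) := by
      have : (0 : ℝ) ≤ m * n := by positivity
      nlinarith
    gcongr
  refine (Finset.sum_le_sum h1).trans ?_
  rw [← Finset.mul_sum, geom_sum_eq (by norm_num)]
  have : (0 : ℝ) ≤ (m + 1) * (n + 1) := by positivity
  refine mul_le_mul_of_nonneg_left ?_ this
  norm_num

/-- The majorant is chosen to close the induction: with `E = exp((m+1)x)`, the derivative of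
`(2lE)^(n+1)` is `(m+1)(n+1)(2lE)^(n+1)`, which dominates the recursion. The factor `2` absorbs the
sum `∑ (j+m+1) 2^j`. -/
theorem IsFirstIntegral.norm_le (hl : 0 < l) (hα : ∀ᵐ x, ∀ i, ‖α i x‖ ≤ l ^ (i + 1)) {m : ℕ}
    {d : ℕ → ℝ → ℂ} (hd : IsFirstIntegral α m d) (n : ℕ) {x : ℝ} (hx : 0 ≤ x) :
    ‖d n x‖ ≤ (2 * l * Real.exp ((m + 1) * x)) ^ n := by
  induction n using Nat.strong_induction_on generalizing x with
  | _ n ih =>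
  cases n with
  | zero => simp [hd.zero]
  | succ n =>
    obtain ⟨K, hK⟩ := exists_lipschitzOnWith_Icc (hd.lipschitz (n + 1)) 0 x
    have hB : ∀ y, HasDerivAt (fun y : ℝ => (2 * l * Real.exp ((m + 1) * y)) ^ (n + 1))
        ((m + 1) * (n + 1) * (2 * l * Real.exp ((m + 1) * y)) ^ (n + 1)) y := by
      intro y
      have h1 : HasDerivAt (fun y : ℝ => 2 * l * Real.exp ((m + 1) * y))
          (2 * l * (Real.exp ((m + 1) * y) * ((m + 1) * 1))) y :=
        (((hasDerivAt_id y).const_mul (m + 1 : ℝ)).exp).const_mul (2 * l)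
      refine (h1.fun_pow (n + 1)).congr_deriv ?_
      rw [Nat.add_sub_cancel]
      push_cast
      ring
    have key := norm_sub_le_of_ae_norm_deriv_le hx hK (B := fun y : ℝ =>
      (2 * l * Real.exp ((m + 1) * y)) ^ (n + 1)) (f' := fun x =>
        -∑ p ∈ Finset.HasAntidiagonal.antidiagonal n, (p.2 + m + 1 : ℂ) * α p.1 x * d p.2 x)
      (B' := fun y => (m + 1) * (n + 1) * (2 * l * Real.exp ((m + 1) * y)) ^ (n + 1))
      ?_ hB (by fun_prop)
    · rw [hd.init, sub_zero] at key
      have : 0 ≤ (2 * l * Real.exp ((m + 1) * 0)) ^ (n + 1) := by positivity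
      linarith
    · filter_upwards [ae_restrict_of_ae hα, ae_restrict_of_ae hd.ode,
        ae_restrict_mem measurableSet_Icc] with y hy1 hy2 hy3
      refine ⟨hy2 n, ?_⟩
      rw [norm_neg]
      set E := Real.exp ((m + 1) * y) with hE
      have hE1 : 1 ≤ E := Real.one_le_exp (mul_nonneg (by positivity) hy3.1)
      calc ‖∑ p ∈ Finset.HasAntidiagonal.antidiagonal n, (p.2 + m + 1 : ℂ) * α p.1 y * d p.2 y‖
          ≤ ∑ p ∈ Finset.HasAntidiagonal.antidiagonal n,
            l ^ (n + 1) * E ^ (n + 1) * ((p.2 + m + 1) * 2 ^ p.2) := by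
            refine norm_sum_le_of_le _ fun p hp => ?_
            have hp' := Finset.HasAntidiagonal.mem_antidiagonal.mp hp
            have h1 := hy1 p.1
            have h2 := ih p.2 (by omega) hy3.1
            have h3 : ‖(p.2 + m + 1 : ℂ)‖ = p.2 + m + 1 := by
              exact_mod_cast Complex.norm_natCast (p.2 + m + 1)
            rw [norm_mul, norm_mul, h3]
            calc (p.2 + m + 1 : ℝ) * ‖α p.1 y‖ * ‖d p.2 y‖
                ≤ (p.2 + m + 1 : ℝ) * l ^ (p.1 + 1) * (2 * l * E) ^ p.2 := by gcongr
              _ = l ^ (n + 1) * E ^ p.2 * ((p.2 + m + 1) * 2 ^ p.2) := by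
                rw [← hp']; ring
              _ ≤ _ := by
                have : E ^ p.2 ≤ E ^ (n + 1) := pow_le_pow_right₀ hE1 (by omega)
                gcongr
        _ = l ^ (n + 1) * E ^ (n + 1) * ∑ j ∈ Finset.range (n + 1), (j + m + 1 : ℝ) * 2 ^ j := by
            rw [← Finset.mul_sum, Finset.Nat.antidiagonal_eq_map', Finset.sum_map]
            rfl
        _ ≤ l ^ (n + 1) * E ^ (n + 1) * ((m + 1) * (n + 1) * 2 ^ (n + 1)) := by
            gcongr
            exact sum_range_succ_mul_two_pow_le n m
        _ = _ := by ring

/-- The partial sums of the right-hand side approximate it geometrically. -/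
theorem norm_sub_sum_range_le {A : ℕ → ℂ} {z s : ℂ} {δ : ℝ} (hA : ∀ i, ‖A i‖ ≤ l ^ (i + 1))
    (hl : 0 < l) (hz : ‖z‖ ≤ δ) (hlδ : l * δ ≤ 1 / 2)
    (hs : HasSum (fun i => A i * z ^ (i + 2)) s) (k : ℕ) :
    ‖s - ∑ i ∈ Finset.range k, A i * z ^ (i + 2)‖ ≤ δ * (1 / 2) ^ k := by
  have hδ : 0 ≤ δ := (norm_nonneg z).trans hz
  have h1 := (hasSum_nat_add_iff' k).mpr hs
  have h2 : HasSum (fun i : ℕ => δ * (1 / 2) ^ k / 2 * (1 / 2) ^ i)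
      (δ * (1 / 2) ^ k / 2 * 2) := hasSum_geometric_two.mul_left _
  have h3 := h1.norm_le_of_bounded h2 fun i => by
    rw [norm_mul, norm_pow]
    calc ‖A (i + k)‖ * ‖z‖ ^ (i + k + 2) ≤ l ^ (i + k + 1) * δ ^ (i + k + 2) := by
          gcongr
          exact hA _
      _ = δ * (l * δ) ^ (i + k + 1) := by ring
      _ ≤ δ * (1 / 2) ^ (i + k + 1) := by gcongr
      _ = _ := by ring
  linarith

theorem locallyLipschitz_sum {ι : Type*} (s : Finset ι) {f : ι → ℝ → ℂ}
    (hf : ∀ i ∈ s, LocallyLipschitz (f i)) : LocallyLipschitz fun x => ∑ i ∈ s, f i x := by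
  classical
  induction s using Finset.induction_on with
  | empty => simpa using LocallyLipschitz.const (0 : ℂ)
  | insert i s hi ih =>
    simp only [Finset.sum_insert hi]
    exact (hf i (Finset.mem_insert_self i s)).add
      (ih fun j hj => hf j (Finset.mem_insert_of_mem hj))

theorem locallyLipschitz_pow {f : ℝ → ℂ} (hf : LocallyLipschitz f) (n : ℕ) :
    LocallyLipschitz fun x => f x ^ n :=
  ((contDiff_id.pow n : ContDiff ℝ 1 fun z : ℂ => z ^ n).locallyLipschitz).comp hf

/-- The partial sums `ψ N` equal `v(0)^(m+1)` at `0` and are nearly constant: their derivative is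
`O(N² / 2^N)`, so their increment over `[0, T]` tends to zero. -/
theorem IsFirstIntegral.hasSum (hl : 0 < l) (hα : ∀ᵐ x, ∀ i, ‖α i x‖ ≤ l ^ (i + 1)) {m : ℕ}
    {d : ℕ → ℝ → ℂ} (hd : IsFirstIntegral α m d) {v : ℝ → ℂ} {T δ : ℝ} (hT : 0 ≤ T)
    {K : NNReal} (hK : LipschitzOnWith K v (Set.Icc 0 T))
    (hv : ∀ᵐ x ∂(volume.restrict (Set.Icc 0 T)), ∃ s : ℂ,
      HasSum (fun i => α i x * v x ^ (i + 2)) s ∧ HasDerivAt v s x)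
    (hδ : ∀ x ∈ Set.Icc 0 T, ‖v x‖ ≤ δ) (hδ1 : δ ≤ 1)
    (hlδ : 2 * l * Real.exp ((m + 1) * T) * δ ≤ 1 / 2) :
    HasSum (fun n => d n T * v T ^ (n + m + 1)) (v 0 ^ (m + 1)) := by
  set D := 2 * l * Real.exp ((m + 1) * T) with hD
  have hδ0 : 0 ≤ δ := (norm_nonneg _).trans (hδ 0 ⟨le_rfl, hT⟩)
  have hexp : 1 ≤ Real.exp ((m + 1) * T) := Real.one_le_exp (by positivity)
  have hlD : l ≤ D := by rw [hD]; nlinarith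
  have hlδ' : l * δ ≤ 1 / 2 := (mul_le_mul_of_nonneg_right hlD hδ0).trans hlδ
  have hD0 : 0 < D := hl.trans_le hlD
  have hdD : ∀ n, ∀ x ∈ Set.Icc 0 T, ‖d n x‖ ≤ D ^ n := fun n x hx => by
    refine (hd.norm_le hl hα n hx.1).trans ?_
    rw [hD]
    have := hx.2
    gcongr
  have hbound : ∀ n, ∀ x ∈ Set.Icc 0 T, ‖d n x * v x ^ (n + m)‖ ≤ (1 / 2) ^ n := fun n x hx => by
    rw [norm_mul, norm_pow, pow_add]
    calc ‖d n x‖ * (‖v x‖ ^ n * ‖v x‖ ^ m) ≤ D ^ n * (δ ^ n * 1) := by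
          gcongr
          · exact hdD n x hx
          · exact hδ x hx
          · exact pow_le_one₀ (norm_nonneg _) ((hδ x hx).trans hδ1)
      _ = (D * δ) ^ n := by ring
      _ ≤ _ := by gcongr
  have hTmem : T ∈ Set.Icc 0 T := ⟨hT, le_rfl⟩
  have hsum : Summable fun n => d n T * v T ^ (n + m + 1) := by
    refine Summable.of_norm_bounded summable_geometric_two fun n => ?_
    rw [pow_succ, ← mul_assoc, norm_mul]
    exact (mul_le_of_le_one_right (norm_nonneg _) ((hδ T hTmem).trans hδ1)).trans
      (hbound n T hTmem)
  let ψ : ℕ → ℝ → ℂ := fun N x => ∑ n ∈ Finset.range (N + 1), d n x * v x ^ (n + m + 1)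
  have hψ0 : ∀ N, ψ N 0 = v 0 ^ (m + 1) := fun N => by
    simp only [ψ]
    rw [Finset.sum_range_succ']
    simp [hd.init, hd.zero]
  have hψlip : ∀ N, ∃ K, LipschitzOnWith K (ψ N) (Set.Icc 0 T) := by
    intro N
    -- As `v` is Lipschitz only on `[0, T]`, it is replaced by its extension constant on either
    -- side.
    have hw : LocallyLipschitz (Set.IccExtend hT (Set.domRestrict (Set.Icc 0 T) v)) :=
      (hK.to_restrict.comp (LipschitzWith.projIcc hT)).locallyLipschitz
    obtain ⟨K', hK'⟩ := exists_lipschitzOnWith_Icc (locallyLipschitz_sum (Finset.range (N + 1))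
      fun n _ => locallyLipschitz_mul (hd.lipschitz n) (locallyLipschitz_pow hw (n + m + 1))) 0 T
    refine ⟨K', fun x hx y hy => ?_⟩
    have h := hK' hx hy
    simp only [Set.IccExtend_of_mem hT _ hx, Set.IccExtend_of_mem hT _ hy] at h
    exact h
  have hψd : ∀ N, ‖ψ N T - ψ N 0‖ ≤ ((1 / 2) ^ N * ((N + 1) * (N + m + 1))) * (T - 0) := by
    intro N
    obtain ⟨K', hK'⟩ := hψlip N
    have : ∀ᵐ x ∂(volume.restrict (Set.Icc 0 T)), ∃ ψ' : ℂ, HasDerivAt (ψ N) ψ' x ∧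
        ‖ψ'‖ ≤ (1 / 2) ^ N * ((N + 1) * (N + m + 1)) := by
      filter_upwards [ae_restrict_of_ae hα, ae_restrict_of_ae hd.ode, hv,
        ae_restrict_mem measurableSet_Icc] with x hx1 hx2 hx3 hx4
      obtain ⟨s, hs, hvs⟩ := hx3
      have hd' : ∀ n, HasDerivAt (d n) (if n = 0 then 0 else
          -∑ p ∈ Finset.HasAntidiagonal.antidiagonal (n - 1),
            (p.2 + m + 1 : ℂ) * α p.1 x * d p.2 x) x := fun n => by
        cases n with
        | zero =>
          have : d 0 = fun _ => 1 := funext hd.zero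
          rw [this, if_pos rfl]
          exact hasDerivAt_const _ _
        | succ n => simpa using hx2 n
      -- All terms cancel except the tails of the field beyond index `N - j`. Such a tail is at most
      -- `(1/2)^(N-j)` and its factor `d_j v^(j+m)` at most `(1/2)^j`, so each summand is bounded by
      -- `(N+m+1) / 2^N`.
      have h1 : HasDerivAt (ψ N) (∑ j ∈ Finset.range (N + 1), (j + m + 1 : ℂ) * d j x *
          v x ^ (j + m) * (s - ∑ i ∈ Finset.range (N - j), α i x * v x ^ (i + 2))) x := by
        have h2 : HasDerivAt (ψ N) _ x := HasDerivAt.fun_sum fun n _ =>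
          (hd' n).mul (hvs.pow (n + m + 1))
        convert h2 using 1
        rw [Finset.sum_add_distrib, Finset.sum_range_succ' (fun n => _ * _ ^ (n + m + 1))]
        have h3 := sum_antidiagonal_mul_pow_succ (fun i => α i x) (fun j => d j x) (v x) m N
        simp only [mul_sub, Finset.sum_sub_distrib, if_true, zero_mul, add_zero,
          Nat.succ_ne_zero, if_false, Nat.add_sub_cancel, neg_mul, Finset.sum_neg_distrib, h3]
        rw [sub_eq_neg_add]
        congr 1
        refine Finset.sum_congr rfl fun j _ => ?_
        push_cast
        ring
      refine ⟨_, h1, ?_⟩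
      calc _ ≤ ∑ j ∈ Finset.range (N + 1), ((1 / 2) ^ N * (N + m + 1) : ℝ) := by
            refine norm_sum_le_of_le _ fun j hj => ?_
            have hj' : j ≤ N := Nat.lt_succ_iff.mp (Finset.mem_range.mp hj)
            have h3 : ‖(j + m + 1 : ℂ)‖ = j + m + 1 := by
              exact_mod_cast Complex.norm_natCast (j + m + 1)
            have h4 := norm_sub_sum_range_le hx1 hl (hδ x hx4) hlδ' hs (N - j)
            rw [mul_assoc _ (d j x), norm_mul, norm_mul, h3]
            calc _ ≤ (N + m + 1 : ℝ) * (1 / 2) ^ j * (1 * (1 / 2) ^ (N - j)) := by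
                  gcongr
                  · exact hbound j x hx4
                  · exact h4.trans (by gcongr)
              _ = (N + m + 1 : ℝ) * ((1 / 2) ^ j * (1 / 2) ^ (N - j)) := by ring
              _ = _ := by rw [← pow_add, Nat.add_sub_cancel' hj', mul_comm]
        _ = _ := by
            rw [Finset.sum_const, Finset.card_range, nsmul_eq_mul]
            push_cast
            ring
    refine norm_sub_le_of_ae_norm_deriv_le_const (f' := deriv (ψ N)) hT hK' ?_
    filter_upwards [this] with x hx
    obtain ⟨ψ', h1, h2⟩ := hx
    rw [h1.deriv]
    exact ⟨h1, h2⟩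
  have hlim : Filter.Tendsto (fun N : ℕ => ((1 / 2 : ℝ) ^ N * ((N + 1) * (N + m + 1))) * (T - 0))
      Filter.atTop (nhds 0) := by
    have h0 := tendsto_pow_const_mul_const_pow_of_abs_lt_one 0 (r := (1 / 2 : ℝ)) (by norm_num [abs_of_pos])
    have h1 := tendsto_pow_const_mul_const_pow_of_abs_lt_one 1 (r := (1 / 2 : ℝ)) (by norm_num [abs_of_pos])
    have h2 := tendsto_pow_const_mul_const_pow_of_abs_lt_one 2 (r := (1 / 2 : ℝ)) (by norm_num [abs_of_pos])
    have := ((h2.add (h1.const_mul (m + 2 : ℝ))).add (h0.const_mul (m + 1 : ℝ))).mul_const (T - 0)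
    simp only [mul_zero, add_zero, zero_mul] at this
    refine this.congr fun N => ?_
    ring
  have h5 : Filter.Tendsto (fun N => ψ N T) Filter.atTop (nhds (v 0 ^ (m + 1))) := by
    rw [tendsto_iff_norm_sub_tendsto_zero]
    refine squeeze_zero (fun _ => norm_nonneg _) (fun N => ?_) hlim
    rw [← hψ0 N]
    exact hψd N
  have h6 := (hsum.hasSum.tendsto_sum_nat).comp (Filter.tendsto_add_atTop_nat 1)
  rw [← tendsto_nhds_unique h6 h5]
  exact hsum.hasSum

end FirstIntegral

/-! ### The nonlinear equation with small initial values -/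

/-- The right-hand side `∑ A_i z^{i+2}` of the nonlinear equation at a fixed time. -/
def field (A : ℕ → ℂ) (z : ℂ) : ℂ := ∑' i, A i * z ^ (i + 2)

section Field

variable {A : ℕ → ℂ} {l δ : ℝ} {z w : ℂ}

theorem norm_term_le (hA : ∀ i, ‖A i‖ ≤ l ^ (i + 1)) (hl : 0 < l) (hz : ‖z‖ ≤ δ)
    (hlδ : l * δ ≤ 1 / 2) (i : ℕ) : ‖A i * z ^ (i + 2)‖ ≤ l * δ ^ 2 * (1 / 2) ^ i := by
  have hδ : 0 ≤ δ := (norm_nonneg z).trans hz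
  rw [norm_mul, norm_pow]
  calc ‖A i‖ * ‖z‖ ^ (i + 2) ≤ l ^ (i + 1) * δ ^ (i + 2) := by
        gcongr
        exact hA i
    _ = l * δ ^ 2 * (l * δ) ^ i := by ring
    _ ≤ _ := by gcongr

theorem hasSum_field (hA : ∀ i, ‖A i‖ ≤ l ^ (i + 1)) (hl : 0 < l) (hz : ‖z‖ ≤ δ)
    (hlδ : l * δ ≤ 1 / 2) : HasSum (fun i => A i * z ^ (i + 2)) (field A z) :=
  (Summable.of_norm_bounded (summable_geometric_two.mul_left _)
    (norm_term_le hA hl hz hlδ)).hasSum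

theorem norm_field_le (hA : ∀ i, ‖A i‖ ≤ l ^ (i + 1)) (hl : 0 < l) (hz : ‖z‖ ≤ δ)
    (hlδ : l * δ ≤ 1 / 2) : ‖field A z‖ ≤ 2 * l * δ ^ 2 := by
  have := (hasSum_field hA hl hz hlδ).norm_le_of_bounded (hasSum_geometric_two.mul_left _)
    (norm_term_le hA hl hz hlδ)
  linarith

theorem norm_pow_sub_pow_le (hz : ‖z‖ ≤ δ) (hw : ‖w‖ ≤ δ) (n : ℕ) :
    ‖z ^ (n + 1) - w ^ (n + 1)‖ ≤ (n + 1) * δ ^ n * ‖z - w‖ := by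
  have hδ : 0 ≤ δ := (norm_nonneg z).trans hz
  induction n with
  | zero => simp
  | succ n ih =>
    have h1 : z ^ (n + 1 + 1) - w ^ (n + 1 + 1) =
        z ^ (n + 1) * (z - w) + (z ^ (n + 1) - w ^ (n + 1)) * w := by ring
    rw [h1]
    refine (norm_add_le _ _).trans ?_
    rw [norm_mul, norm_mul, norm_pow]
    calc ‖z‖ ^ (n + 1) * ‖z - w‖ + ‖z ^ (n + 1) - w ^ (n + 1)‖ * ‖w‖
        ≤ δ ^ (n + 1) * ‖z - w‖ + ((n + 1) * δ ^ n * ‖z - w‖) * δ := by gcongr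
      _ = _ := by push_cast; ring

/-- Termwise comparison using `lδ ≤ 1/2`; the constant is `∑ (i+2) / 2^i = 6`. -/
theorem norm_field_sub_le (hA : ∀ i, ‖A i‖ ≤ l ^ (i + 1)) (hl : 0 < l) (hz : ‖z‖ ≤ δ)
    (hw : ‖w‖ ≤ δ) (hlδ : l * δ ≤ 1 / 2) :
    ‖field A z - field A w‖ ≤ 6 * l * δ * ‖z - w‖ := by
  have hδ : 0 ≤ δ := (norm_nonneg z).trans hz
  have h1 := (hasSum_field hA hl hz hlδ).sub (hasSum_field hA hl hw hlδ)
  have h2 : HasSum (fun i : ℕ => l * δ * ‖z - w‖ * (i * (1 / 2) ^ i + 2 * (1 / 2) ^ i))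
      (l * δ * ‖z - w‖ * ((1 / 2) / (1 - 1 / 2) ^ 2 + 2 * 2)) :=
    ((hasSum_coe_mul_geometric_of_norm_lt_one (r := (1 / 2 : ℝ)) (by norm_num [abs_of_pos])).add
      (hasSum_geometric_two.mul_left 2)).mul_left _
  have h3 := h1.norm_le_of_bounded h2 fun i => by
    rw [← mul_sub, norm_mul]
    have h4 := norm_pow_sub_pow_le hz hw (i + 1)
    calc ‖A i‖ * ‖z ^ (i + 2) - w ^ (i + 2)‖
        ≤ l ^ (i + 1) * (((i + 1 : ℕ) + 1) * δ ^ (i + 1) * ‖z - w‖) := by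
          gcongr
          exact hA i
      _ = l * δ * ‖z - w‖ * (i + 2) * (l * δ) ^ i := by push_cast; ring
      _ ≤ l * δ * ‖z - w‖ * (i + 2) * (1 / 2) ^ i := by gcongr
      _ = _ := by ring
  norm_num at h3
  linarith

end Field

theorem norm_integral_le_of_indicator {h : ℝ → ℂ} {C T : ℝ} (hT : 0 ≤ T) (hC : 0 ≤ C)
    (hh : ∀ᵐ x, ‖h x‖ ≤ (Set.Icc 0 T).indicator (fun _ => C) x) (x : ℝ) :
    ‖∫ t in (0 : ℝ)..x, h t‖ ≤ C * T := by
  have hi : Integrable ((Set.Icc 0 T).indicator fun _ => C) :=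
    continuous_const.integrableOn_Icc.integrable_indicator measurableSet_Icc
  calc ‖∫ t in (0 : ℝ)..x, h t‖ ≤ ∫ t in Set.uIoc 0 x, ‖h t‖ :=
        intervalIntegral.norm_integral_le_integral_norm_uIoc
    _ ≤ ∫ t in Set.uIoc 0 x, (Set.Icc 0 T).indicator (fun _ => C) t :=
        integral_mono_of_nonneg (Filter.Eventually.of_forall fun _ => norm_nonneg _)
          hi.integrableOn (ae_restrict_of_ae hh)
    _ ≤ ∫ t, (Set.Icc 0 T).indicator (fun _ => C) t :=
        setIntegral_le_integral hi
          (Filter.Eventually.of_forall (Set.indicator_nonneg fun _ _ => hC))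
    _ = C * T := by
        rw [integral_indicator measurableSet_Icc]
        simp [hT, mul_comm]

section Solutions

variable {α : ℕ → ℝ → ℂ} {l δ T : ℝ}

/-- The right-hand side along `v`, cut off outside `[0, T]`. -/
def fieldAlong (α : ℕ → ℝ → ℂ) (T : ℝ) (v : ℝ → ℂ) : ℝ → ℂ :=
  (Set.Icc 0 T).indicator fun x => field (fun i => α i x) (v x)

theorem norm_fieldAlong_le (hl : 0 < l) (hα : ∀ᵐ x, ∀ i, ‖α i x‖ ≤ l ^ (i + 1))
    (hlδ : l * δ ≤ 1 / 2) {v : ℝ → ℂ} (hv : ∀ x, ‖v x‖ ≤ δ) :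
    ∀ᵐ x, ‖fieldAlong α T v x‖ ≤ (Set.Icc 0 T).indicator (fun _ => 2 * l * δ ^ 2) x := by
  filter_upwards [hα] with x hx
  rw [fieldAlong, norm_indicator_eq_indicator_norm]
  exact Set.indicator_le_indicator (norm_field_le hx hl (hv x) hlδ)

theorem integrable_fieldAlong (hm : ∀ i, Measurable (α i)) (hl : 0 < l)
    (hα : ∀ᵐ x, ∀ i, ‖α i x‖ ≤ l ^ (i + 1)) (hlδ : l * δ ≤ 1 / 2) {v : ℝ → ℂ}
    (hvc : Continuous v) (hv : ∀ x, ‖v x‖ ≤ δ) : Integrable (fieldAlong α T v) := by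
  refine Integrable.mono' (g := (Set.Icc 0 T).indicator (fun _ => 2 * l * δ ^ 2))
    (continuous_const.integrableOn_Icc.integrable_indicator measurableSet_Icc) ?_
    (norm_fieldAlong_le hl hα hlδ hv)
  refine AEStronglyMeasurable.indicator ?_ measurableSet_Icc
  refine aestronglyMeasurable_of_tendsto_ae Filter.atTop
    (f := fun n x => ∑ i ∈ Finset.range n, α i x * v x ^ (i + 2)) (fun n => ?_) ?_
  · exact (Finset.measurable_sum _ fun i _ =>
      (hm i).mul (hvc.measurable.pow_const _)).aestronglyMeasurable
  · filter_upwards [hα] with x hx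
    exact (hasSum_field hx hl (hv x) hlδ).tendsto_sum_nat

/-- Picard's theorem for the nonlinear equation with small initial value. -/
theorem exists_solution (hm : ∀ i, Measurable (α i)) (hl : 0 < l)
    (hα : ∀ᵐ x, ∀ i, ‖α i x‖ ≤ l ^ (i + 1)) (hT : 0 ≤ T) (hδ : 0 ≤ δ)
    (hlδ : l * δ ≤ 1 / 2) (hT' : 12 * l * δ * T ≤ 1) {r : ℂ} (hr : ‖r‖ ≤ δ / 2) :
    ∃ v : ℝ → ℂ, v 0 = r ∧ (∃ K, LipschitzWith K v) ∧
      ∀ᵐ x, x ∈ Set.Icc 0 T → ∃ s : ℂ,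
        HasSum (fun i => α i x * v x ^ (i + 2)) s ∧ HasDerivAt v s x := by
  -- Picard iteration on the `δ`-ball of bounded continuous functions on the whole line, made
  -- possible by the cutoff in `fieldAlong`. The condition `12lδT ≤ 1` makes the Lipschitz constant
  -- `6lδT` at most `1/2` and the displacement `2lδ²T` at most `δ/6`.
  let X := Metric.closedBall (0 : BoundedContinuousFunction ℝ ℂ) δ
  have hX : ∀ (v : X) x, ‖(v : BoundedContinuousFunction ℝ ℂ) x‖ ≤ δ := fun v x =>
    (BoundedContinuousFunction.norm_coe_le_norm _ x).trans (mem_closedBall_zero_iff.mp v.2)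
  have hint : ∀ v : X, Integrable (fieldAlong α T (v : BoundedContinuousFunction ℝ ℂ)) := fun v =>
    integrable_fieldAlong hm hl hα hlδ (v : BoundedContinuousFunction ℝ ℂ).continuous (hX v)
  have hex : ∀ v : X, ∃ w : X, ∀ x, (w : BoundedContinuousFunction ℝ ℂ) x =
      r + ∫ t in (0 : ℝ)..x, fieldAlong α T (v : BoundedContinuousFunction ℝ ℂ) t := by
    intro v
    have hb : ∀ x, ‖r + ∫ t in (0 : ℝ)..x,
        fieldAlong α T (v : BoundedContinuousFunction ℝ ℂ) t‖ ≤ δ := fun x => by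
      refine (norm_add_le _ _).trans ?_
      have := norm_integral_le_of_indicator hT (by positivity)
        (norm_fieldAlong_le (T := T) hl hα hlδ (hX v)) x
      nlinarith
    refine ⟨⟨BoundedContinuousFunction.ofNormedAddCommGroup _
      (continuous_const.add (intervalIntegral.continuous_primitive
        (fun a b => (hint v).intervalIntegrable) 0)) δ hb, ?_⟩, fun x => rfl⟩
    exact mem_closedBall_zero_iff.mpr
      (BoundedContinuousFunction.norm_ofNormedAddCommGroup_le _ hδ hb)
  choose Φ hΦ using hex
  have hcontr : ContractingWith (1 / 2) Φ := by
    refine ⟨by norm_num, LipschitzWith.of_dist_le_mul fun v w => ?_⟩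
    rw [Subtype.dist_eq, BoundedContinuousFunction.dist_le (by positivity)]
    intro x
    rw [hΦ, hΦ, dist_add_left, dist_eq_norm, ← intervalIntegral.integral_sub
      (hint v).intervalIntegrable (hint w).intervalIntegrable]
    have h1 := norm_integral_le_of_indicator (C := 6 * l * δ * dist v w) hT (by positivity)
      (h := fun t => fieldAlong α T (v : BoundedContinuousFunction ℝ ℂ) t -
        fieldAlong α T (w : BoundedContinuousFunction ℝ ℂ) t) ?_ x
    · refine h1.trans ?_
      have : (0 : ℝ) ≤ dist v w := dist_nonneg
      push_cast
      nlinarith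
    · filter_upwards [hα] with t ht
      simp only [fieldAlong]
      by_cases htT : t ∈ Set.Icc 0 T
      · simp only [Set.indicator_of_mem htT]
        refine (norm_field_sub_le ht hl (hX v t) (hX w t) hlδ).trans ?_
        refine mul_le_mul_of_nonneg_left ?_ (by positivity)
        rw [← dist_eq_norm, Subtype.dist_eq]
        exact BoundedContinuousFunction.dist_coe_le_dist t
      · simp [Set.indicator_of_notMem htT]
  have : CompleteSpace X := Metric.isClosed_closedBall.completeSpace_coe
  obtain ⟨v, hv, -⟩ := hcontr.exists_fixedPoint
    ⟨0, mem_closedBall_zero_iff.mpr (by simpa using hδ)⟩ (edist_ne_top _ _)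
  have hve : ∀ x, (v : BoundedContinuousFunction ℝ ℂ) x =
      r + ∫ t in (0 : ℝ)..x, fieldAlong α T (v : BoundedContinuousFunction ℝ ℂ) t := fun x => by
    conv_lhs => rw [← hv]
    exact hΦ v x
  refine ⟨fun x => (v : BoundedContinuousFunction ℝ ℂ) x, by simp [hve 0],
    ⟨(2 * l * δ ^ 2).toNNReal, LipschitzWith.of_dist_le_mul fun x y => ?_⟩, ?_⟩
  · rw [hve x, hve y, dist_add_left, dist_eq_norm, intervalIntegral.integral_interval_sub_left
      (hint v).intervalIntegrable (hint v).intervalIntegrable, Real.dist_eq,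
      Real.coe_toNNReal _ (by positivity)]
    refine intervalIntegral.norm_integral_le_of_norm_le_const_ae ?_
    filter_upwards [norm_fieldAlong_le (T := T) hl hα hlδ (hX v)] with t ht _
    exact ht.trans (Set.indicator_le_self' (fun _ _ => by positivity) t)
  · filter_upwards [hα, LocallyIntegrable.ae_hasDerivAt_integral (hint v).locallyIntegrable]
      with x hx hd hxT
    refine ⟨_, hasSum_field hx hl (hX v x) hlδ, ?_⟩
    have h1 := (hd 0).const_add r
    have h2 : (fun x => (v : BoundedContinuousFunction ℝ ℂ) x) = fun x =>
      r + ∫ t in (0 : ℝ)..x, fieldAlong α T (v : BoundedContinuousFunction ℝ ℂ) t := funext hve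
    rw [← h2] at h1
    exact h1.congr_deriv (Set.indicator_of_mem hxT fun x =>
      field (fun i => α i x) ((v : BoundedContinuousFunction ℝ ℂ) x))

/-- A solution with small initial value stays small. -/
theorem norm_solution_le (hl : 0 < l) (hα : ∀ᵐ x, ∀ i, ‖α i x‖ ≤ l ^ (i + 1))
    (hδ : 0 < δ) (hlδ : l * δ ≤ 1 / 2) (hT' : 12 * l * δ * T ≤ 1) {v : ℝ → ℂ}
    {K : NNReal} (hK : LipschitzOnWith K v (Set.Icc 0 T))
    (hv : ∀ᵐ x ∂(volume.restrict (Set.Icc 0 T)), ∃ s : ℂ,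
      HasSum (fun i => α i x * v x ^ (i + 2)) s ∧ HasDerivAt v s x)
    (h0 : ‖v 0‖ < δ / 2) : ∀ x ∈ Set.Icc 0 T, ‖v x‖ ≤ δ := by
  by_contra! hcon
  obtain ⟨x, hxT, hx⟩ := hcon
  have hcont : ContinuousOn (fun x => ‖v x‖) (Set.Icc 0 T) := hK.continuousOn.norm
  have hcl : IsCompact (Set.Icc 0 T ∩ (fun x => ‖v x‖) ⁻¹' Set.Ici δ) :=
    isCompact_Icc.of_isClosed_subset (hcont.preimage_isClosed_of_isClosed isClosed_Icc isClosed_Ici)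
      Set.inter_subset_left
  -- Let `y` be the first time with `‖v y‖ ≥ δ`. Before `y` the field is at most `2lδ²`, so `v`
  -- moves by at most `δ/6` from a value below `δ/2`, a contradiction. The time `y` itself is
  -- discarded as a null set.
  obtain ⟨y, ⟨hyT, hyδ⟩, hmin⟩ := hcl.exists_isLeast ⟨x, hxT, hx.le⟩
  have hsub : Set.Icc 0 y ⊆ Set.Icc 0 T := Set.Icc_subset_Icc_right hyT.2
  have hlt : ∀ t ∈ Set.Icc 0 y, t ≠ y → ‖v t‖ ≤ δ := fun t ht hty => by
    by_contra! hc
    exact hty (le_antisymm ht.2 (hmin ⟨hsub ht, hc.le⟩))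
  have hne : ∀ᵐ t : ℝ, t ≠ y := by simp [ae_iff, measure_singleton]
  have h1 := norm_sub_le_of_ae_norm_deriv_le_const (f := v) (f' := deriv v) (C := 2 * l * δ ^ 2)
    hyT.1 (hK.mono hsub) (by
      filter_upwards [ae_restrict_of_ae_restrict_of_subset hsub hv, ae_restrict_of_ae hα,
        ae_restrict_of_ae hne, ae_restrict_mem measurableSet_Icc] with t ht1 ht2 ht3 ht4
      obtain ⟨s, hs, hd⟩ := ht1
      rw [hd.deriv]
      refine ⟨hd, ?_⟩
      rw [hs.unique (hasSum_field ht2 hl (hlt t ht4 ht3) hlδ)]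
      exact norm_field_le ht2 hl (hlt t ht4 ht3) hlδ)
  have h2 : ‖v y‖ ≤ ‖v y - v 0‖ + ‖v 0‖ := by simpa using norm_add_le (v y - v 0) (v 0)
  have h3 : δ ≤ ‖v y‖ := hyδ
  have h4 : 2 * l * δ ^ 2 * (y - 0) ≤ 2 * l * δ ^ 2 * T := by
    rw [sub_zero]
    exact mul_le_mul_of_nonneg_left hyT.2 (by positivity)
  nlinarith

end Solutions

/-! ### Identity principle for the return series -/

/-- The coefficients of a power series with geometric bounds vanishing near `0` are zero. -/
theorem eq_zero_of_hasSum_zero {e : ℕ → ℂ} {D C ρ : ℝ} {k : ℕ} (hD : 0 < D) (hC : 0 ≤ C)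
    (he : ∀ n, ‖e n‖ ≤ C * D ^ n) (hρ : 0 < ρ)
    (h : ∀ r : ℝ, 0 < r → r < ρ → HasSum (fun n => e n * (r : ℂ) ^ (n + k)) 0) (n : ℕ) :
    e n = 0 := by
  induction n using Nat.strong_induction_on with
  | _ n ih =>
    -- With the earlier coefficients zero, the term of index `n` is minus the tail, which has one
    -- more power of `r`; dividing by `r^(n+k)` and letting `r → 0` gives `e n = 0`.
    have key : ∀ r : ℝ, 0 < r → r < min ρ (1 / (2 * D)) → ‖e n‖ ≤ 2 * C * D ^ (n + 1) * r := by
      intro r hr hr'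
      have hDr : D * r ≤ 1 / 2 := by
        have := (lt_min_iff.mp hr').2
        rw [lt_div_iff₀ (by positivity)] at this
        linarith
      have h1 := (hasSum_nat_add_iff' (n + 1)).mpr (h r hr (lt_min_iff.mp hr').1)
      rw [Finset.sum_range_succ, Finset.sum_eq_zero fun j hj => by
        rw [ih j (Finset.mem_range.mp hj), zero_mul], zero_add, zero_sub] at h1
      have h2 := h1.norm_le_of_bounded
        (hasSum_geometric_two.mul_left (C * D ^ (n + 1) * r ^ (n + 1 + k))) fun j => by
          rw [norm_mul, norm_pow, Complex.norm_real, Real.norm_of_nonneg hr.le]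
          calc ‖e (j + (n + 1))‖ * r ^ (j + (n + 1) + k)
              ≤ C * D ^ (j + (n + 1)) * r ^ (j + (n + 1) + k) := by
                gcongr
                exact he _
            _ = C * D ^ (n + 1) * r ^ (n + 1 + k) * (D * r) ^ j := by ring
            _ ≤ _ := by gcongr
      rw [norm_neg, norm_mul, norm_pow, Complex.norm_real, Real.norm_of_nonneg hr.le] at h2
      refine le_of_mul_le_mul_right (h2.trans_eq ?_) (pow_pos hr (n + k))
      ring
    by_contra hne
    have hpos : 0 < ‖e n‖ := norm_pos_iff.mpr hne
    have hlim : Filter.Tendsto (fun r : ℝ => 2 * C * D ^ (n + 1) * r) (nhdsWithin 0 (Set.Ioi 0))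
        (nhds 0) := by
      have : Continuous fun r : ℝ => 2 * C * D ^ (n + 1) * r := by fun_prop
      simpa using (this.tendsto 0).mono_left nhdsWithin_le_nhds
    have hev : ∀ᶠ r in nhdsWithin (0 : ℝ) (Set.Ioi 0), ‖e n‖ ≤ 2 * C * D ^ (n + 1) * r := by
      filter_upwards [Ioo_mem_nhdsGT (lt_min hρ (by positivity : 0 < 1 / (2 * D)))] with r hr
      exact key r hr.1 hr.2
    exact absurd (ge_of_tendsto hlim hev) (not_le.mpr hpos)

/-! ### Center condition versus trivial monodromy -/

section Final

variable {a : ℕ+ → LInfty}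

theorem hasSum_val_iff {x : ℝ} {z s : ℂ} :
    HasSum (fun i : ℕ+ => val a i x * z ^ ((i : ℕ) + 1)) s ↔
      HasSum (fun i : ℕ => coef a i x * z ^ (i + 2)) s :=
  (Equiv.pnatEquivNat.symm.hasSum_iff
    (f := fun i : ℕ+ => val a i x * z ^ ((i : ℕ) + 1))).symm

/-- The matrix entries of `rightSolution` in the representation `rep`. -/
def integralCoeff (a : ℕ+ → LInfty) (m n : ℕ) (x : ℝ) : ℂ :=
  entry n m (PowerSeries.coeff n (rightSolution a x))

/-- Apply `entry` to `G' = -Gω` and collapse each product with `entry_mul`. -/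
theorem isFirstIntegral_integralCoeff (ha : a ∈ coeffSpace) (m : ℕ) :
    IsFirstIntegral (coef a) m (integralCoeff a m) where
  zero x := by rw [integralCoeff, coeff_zero_rightSolution, entry_zero_one]
  init n := by
    rw [integralCoeff, rightSolution_zero ha, PowerSeries.coeff_one, if_neg n.succ_ne_zero,
      map_zero]
  lipschitz n := ((hasLipschitzDeriv_rightSolution ha n).map (entry n m)).scalar.1
  ode := by
    refine ae_all_iff.mpr fun n => ?_
    filter_upwards [((hasLipschitzDeriv_rightSolution ha (n + 1)).map (entry (n + 1) m)).scalar.2]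
      with x hx
    refine hx.congr_deriv ?_
    rw [map_neg, coeff_succ_mul_omega, map_sum]
    congr 1
    refine Finset.sum_congr rfl fun p hp => ?_
    rw [map_smul, ← Finset.HasAntidiagonal.mem_antidiagonal.mp hp, entry_mul, smul_eq_mul,
      integralCoeff]
    ring

theorem coeff_rightSolution_mem (ha : a ∈ coeffSpace) (n : ℕ) (x : ℝ) :
    PowerSeries.coeff n (rightSolution a x) ∈ homogeneous n := by
  induction n using Nat.strong_induction_on generalizing x with
  | _ n ih =>
  cases n with
  | zero =>
    rw [coeff_zero_rightSolution]
    simpa using monomial_mem_homogeneous 0 0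
  | succ n =>
    have h := (hasLipschitzDeriv_rightSolution ha (n + 1)).sub_mem (homogeneous (n + 1))
      (Filter.Eventually.of_forall fun y => by
        rw [coeff_succ_mul_omega]
        refine neg_mem (sum_mem fun p hp => Submodule.smul_mem _ _ ?_)
        have hp' := Finset.HasAntidiagonal.mem_antidiagonal.mp hp
        have h1 := mul_S₂_mem (mul_S₁_mem (ih p.2 (by omega) y)) p.1
        rw [mul_assoc] at h1
        rwa [← hp', show p.1 + p.2 + 1 = p.2 + 1 + p.1 by ring]) x 0
    rwa [rightSolution_zero ha, PowerSeries.coeff_one, if_neg n.succ_ne_zero, sub_zero] at h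

/-- The two solutions are mutually inverse, so it suffices to treat `rightSolution`, whose
coefficients are homogeneous and hence detected by their entries. -/
theorem leftSolution_eq_one_iff (ha : a ∈ coeffSpace) (x : ℝ) :
    leftSolution a x = 1 ↔ ∀ m n, integralCoeff a m (n + 1) x = 0 := by
  have hmul := rightSolution_mul_leftSolution ha x
  constructor
  · intro h m n
    rw [h, mul_one] at hmul
    rw [integralCoeff, hmul, PowerSeries.coeff_one, if_neg n.succ_ne_zero, map_zero]
  · intro h
    have : rightSolution a x = 1 := by
      ext n
      cases n with
      | zero => simp [coeff_zero_rightSolution]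
      | succ n =>
        rw [PowerSeries.coeff_one, if_neg n.succ_ne_zero]
        exact eq_zero_of_entry_eq_zero (coeff_rightSolution_mem ha _ x) fun m => h m n
    rwa [this, one_mul] at hmul

/-- For small initial values, solutions exist, and `∑ d_n(x) v(x)^{n+m+1}` is a first integral. -/
theorem exists_small_radius (ha : a ∈ coeffSpace) (m : ℕ) : ∃ ε : ℝ, 0 < ε ∧ ∀ r : ℂ, ‖r‖ < ε →
    (∃ v : ℝ → ℂ, IsSolution a v ∧ v 0 = r) ∧
    ∀ v : ℝ → ℂ, IsSolution a v → v 0 = r →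
      HasSum (fun n => integralCoeff a m n (2 * Real.pi) * v (2 * Real.pi) ^ (n + m + 1))
        (r ^ (m + 1)) := by
  obtain ⟨l, hl, hal⟩ := ha
  have hα := ae_norm_coef_le hal
  have hT : 0 < 2 * Real.pi := Real.two_pi_pos
  set E := Real.exp ((m + 1) * (2 * Real.pi)) with hE
  have hE1 : 1 ≤ E := Real.one_le_exp (by positivity)
  -- The three summands of `M` serve the three smallness conditions on `δ = 1 / M`: `δ ≤ 1`,
  -- convergence of the first integral, and the Picard condition.
  set M := 1 + 4 * l * E + 12 * l * (2 * Real.pi) with hM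
  have hM0 : 0 < M := by positivity
  have hlE : l ≤ l * E := le_mul_of_one_le_right hl.le hE1
  have hlT : 0 < l * (2 * Real.pi) := by positivity
  have hMδ : M * (1 / M) = 1 := mul_one_div_cancel hM0.ne'
  obtain ⟨δ, hδ⟩ : ∃ δ, δ = 1 / M := ⟨_, rfl⟩
  rw [← hδ] at hMδ
  have hδ0 : 0 < δ := by rw [hδ]; positivity
  have c0 : 0 < l * E * δ := by positivity
  have c1 : 0 < l * (2 * Real.pi) * δ := by positivity
  have hsplit : δ + 4 * (l * E * δ) + 12 * (l * (2 * Real.pi) * δ) = 1 := by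
    rw [← hMδ, hM]; ring
  have h1 : δ ≤ 1 := by linarith
  have h2 : 2 * l * E * δ ≤ 1 / 2 := by linarith
  have h3 : l * δ ≤ 1 / 2 := by
    have := mul_le_mul_of_nonneg_right hlE hδ0.le
    linarith
  have h4 : 12 * l * δ * (2 * Real.pi) ≤ 1 := by linarith
  refine ⟨δ / 2, by positivity, fun r hr => ⟨?_, ?_⟩⟩
  · obtain ⟨v, hv0, ⟨K, hK⟩, hv⟩ :=
      exists_solution (measurable_coef a) hl hα hT.le hδ0.le h3 h4 hr.le
    refine ⟨v, ⟨⟨K, hK.lipschitzOnWith⟩, ?_⟩, hv0⟩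
    filter_upwards [ae_restrict_of_ae hv, ae_restrict_mem measurableSet_Icc] with x hx hxT
    obtain ⟨s, hs, hd⟩ := hx hxT
    exact ⟨s, hasSum_val_iff.mpr hs, hd⟩
  · rintro v ⟨⟨K, hK⟩, hv⟩ rfl
    have hv' : ∀ᵐ x ∂(volume.restrict (Set.Icc 0 (2 * Real.pi))), ∃ s : ℂ,
        HasSum (fun i => coef a i x * v x ^ (i + 2)) s ∧ HasDerivAt v s x := by
      filter_upwards [hv] with x hx
      obtain ⟨s, hs, hd⟩ := hx
      exact ⟨s, hasSum_val_iff.mp hs, hd⟩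
    exact (isFirstIntegral_integralCoeff ⟨l, hl, hal⟩ m).hasSum hl hα hT.le hK hv'
      (norm_solution_le hl hα hδ0 h3 h4 hK hv' hr) h1 h2

theorem determinesCenter_iff (ha : a ∈ coeffSpace) :
    DeterminesCenter a ↔ leftSolution a (2 * Real.pi) = 1 := by
  rw [leftSolution_eq_one_iff ha]
  constructor
  · rintro ⟨ε₁, hε₁, hc⟩ m n
    obtain ⟨ε₂, hε₂, hi⟩ := exists_small_radius ha m
    obtain ⟨l, hl, hal⟩ := id ha
    have hb := (isFirstIntegral_integralCoeff ha m).norm_le hl (ae_norm_coef_le hal)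
    set D := 2 * l * Real.exp ((m + 1) * (2 * Real.pi)) with hD
    have hD0 : 0 < D := by positivity
    -- Since `v(2π) = r`, the term `n = 0` cancels `r^(m+1)`, and the remaining series starts at
    -- exponent `m + 2`. The radius may depend on `m`, as each `m` is treated separately.
    refine eq_zero_of_hasSum_zero (e := fun n => integralCoeff a m (n + 1) (2 * Real.pi))
      (k := m + 2) hD0 hD0.le (fun n => ?_) (lt_min hε₁ hε₂) (fun r hr hr' => ?_) n
    · exact (hb (n + 1) Real.two_pi_pos.le).trans_eq (pow_succ' D n)
    · have hnorm : ‖(r : ℂ)‖ = r := by rw [Complex.norm_real, Real.norm_of_nonneg hr.le]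
      obtain ⟨⟨v, hv, hv0⟩, hret⟩ := hc r (by rw [hnorm]; exact (lt_min_iff.mp hr').1)
      have h1 := (hi r (by rw [hnorm]; exact (lt_min_iff.mp hr').2)).2 v hv hv0
      rw [hret v hv hv0, ← hasSum_nat_add_iff' 1] at h1
      simp only [Finset.sum_range_one, (isFirstIntegral_integralCoeff ha m).zero, one_mul,
        zero_add, sub_self] at h1
      simpa only [show ∀ n, n + 1 + m + 1 = n + (m + 2) from fun n => by ring] using h1
  · intro h
    -- Here `m = 0` suffices: the first integral reduces to its leading term `v(2π)`.
    obtain ⟨ε, hε, hi⟩ := exists_small_radius ha 0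
    refine ⟨ε, hε, fun r hr => ⟨(hi r hr).1, fun v hv hv0 => ?_⟩⟩
    have h1 := (hi r hr).2 v hv hv0
    have h2 := hasSum_single (f := fun n =>
      integralCoeff a 0 n (2 * Real.pi) * v (2 * Real.pi) ^ (n + 0 + 1)) 0 (fun n hn => by
        obtain ⟨k, rfl⟩ := Nat.exists_eq_succ_of_ne_zero hn
        rw [Nat.succ_eq_add_one, h 0 k, zero_mul])
    have h3 := h2.unique h1
    simpa [(isFirstIntegral_integralCoeff ha 0).zero] using h3

end Final

end CenterProblem

end

/-- The linear equation has exactly one monodromy homomorphism, and the nonlinear equation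
determines a center if and only if that monodromy is trivial. -/
theorem theorem2p1 (a : ℕ+ → CenterProblem.LInfty) (ha : a ∈ CenterProblem.coeffSpace) :
    ∃ ρ : Multiplicative ℤ →* (PowerSeries CenterProblem.Alg)ˣ,
      (∀ ρ' : Multiplicative ℤ →* (PowerSeries CenterProblem.Alg)ˣ,
        CenterProblem.IsMonodromy a ρ' ↔ ρ' = ρ) ∧
      (CenterProblem.DeterminesCenter a ↔ ρ = 1) := by
  have hF := CenterProblem.isFundamentalSolution ha
  have hρ : ∀ n : ℤ, zpowersHom _ (CenterProblem.fundamentalSolution a (2 * Real.pi))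
      (Multiplicative.ofAdd n) = CenterProblem.fundamentalSolution a (2 * Real.pi * n) := fun n => by
    rw [hF.two_pi_mul_int, zpowersHom_apply, toAdd_ofAdd]
  refine ⟨zpowersHom _ (CenterProblem.fundamentalSolution a (2 * Real.pi)),
    fun ρ' => ⟨?_, ?_⟩, ?_⟩
  · rintro ⟨F, hF', h⟩
    ext n
    rw [h, hF'.unique hF, hρ]
  · rintro rfl
    exact ⟨_, hF, hρ⟩
  · have h1 : zpowersHom (PowerSeries CenterProblem.Alg)ˣ 1 = 1 := by
      ext n
      simp
    rw [CenterProblem.determinesCenter_iff ha, ← CenterProblem.coe_fundamentalSolution,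
      Units.val_eq_one, ← h1, (zpowersHom _).injective.eq_iff]
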